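/- All graphs are finite and simple. A graph is cubic if every vertex has degree $3$, and 2-connected if it has at least three vertices, is connected, and stays connected after the deletion of any one vertex. A triangle is a set of three pairwise adjacent vertices together with the three edges joining them; a claw is a graph isomorphic to $K_{1,3}$. A $\Lambda$-factor of a graph is a spanning subgraph each of whose components is a 3-vertex path. For a set $E$ of edges of $G$, $G-E$ is obtained from $G$ by deleting the edges in $E$ (keeping all vertices), and $\dot E$ is the subgraph whose edges are those in $E$ and whose vertices are their ends. For a cubic graph $F$, $F^\Delta$ is the graph obtained from $F$ by replacing every vertex $x$ by a triangle whose three vertices are matched with the three edges at $x$; an edge $xy$ of $F$ becomes an edge joining the corresponding vertices of the triangles of $x$ and of $y$. (A) Let $G$ be a cubic 2-connected graph in which every vertex belongs to exactly one triangle, and let $E\subseteq E(G)$ with $|E|=3$. Then $G-E$ has no $\Lambda$-factor if and only if one of the following holds: (e1) $\dot E$ is a claw; (e2) $\dot E$ is a triangle; (e3) $\dot E$ has exactly two components, one with two edges and one with one edge; the 2-edge component belongs to a triangle of $G$, the 1-edge component belongs to no triangle of $G$, and $G-E$ is not connected; (e4) $\dot E$ has exactly two components, a component $\dot E_2$ with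 two edges and a component $\dot E_1$ with one edge; $\dot E_2$ belongs to a triangle $T$ of $G$, $\dot E_1$ belongs to a triangle $D$ of $G$, and $\dot E_1$ and $\dot E_2$ belong to different components of $G-\{d,t\}$, where $d$ is the edge not in $D$ that is incident to the vertex of $D$ not in $\dot E_1$, and $t$ is the edge of $G-E$ incident to the vertex that becomes isolated when the edges in $E$ are deleted from $T$. (B) For every cubic 2-connected graph $F$, the graph $F^\Delta$ is cubic and 2-connected and every one of its vertices belongs to exactly one triangle; so (A) applies to $G=F^\Delta$. -/

import Mathlib

namespace LambdaFactor

variable {V : Type*}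

/-- Every vertex has exactly three neighbours. -/
def IsCubic (G : SimpleGraph V) : Prop :=
  ∀ v, (G.neighborSet v).ncard = 3

/-- 2-connected (finite) graph: at least three vertices, connected, and still connected after
the deletion of any single vertex. -/
def IsTwoConnected (G : SimpleGraph V) : Prop :=
  3 ≤ Nat.card V ∧ G.Connected ∧ ∀ v : V, (G.induce {v}ᶜ).Connected

/-- `T` is the vertex set of a triangle of `G`. -/
def IsTriangle (G : SimpleGraph V) (T : Finset V) : Prop :=
  G.IsNClique 3 T

/-- Every vertex of `G` belongs to exactly one triangle. -/
def UniqueTriangles (G : SimpleGraph V) : Prop :=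
  ∀ v, ∃! T : Finset V, IsTriangle G T ∧ v ∈ T

/-- `F^Δ`: every vertex `x` of `F` is replaced by a clique on the darts (oriented edges) leaving
`x`, a triangle when `F` is cubic; the edge `xy` of `F` becomes the edge joining the dart from `x`
to `y` with the dart from `y` to `x`. -/
def triangleReplacement (F : SimpleGraph V) : SimpleGraph F.Dart where
  Adj a b := (a ≠ b ∧ a.fst = b.fst) ∨ b = a.symm
  symm := ⟨by
    rintro a b (⟨h, h'⟩ | h)
    · exact Or.inl ⟨h.symm, h'.symm⟩
    · exact Or.inr (by rw [h, SimpleGraph.Dart.symm_symm])⟩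
  loopless := ⟨by
    rintro a (⟨h, -⟩ | h)
    · exact h rfl
    · exact a.symm_ne h.symm⟩

/-- `G` has a `Λ`-factor: a spanning subgraph every component of which is a 3-vertex path. -/
def HasLambdaFactor (G : SimpleGraph V) : Prop :=
  ∃ H : SimpleGraph V, H ≤ G ∧
    ∀ C : H.ConnectedComponent, Nonempty (H.induce C.supp ≃g SimpleGraph.pathGraph 3)

/-- The graph `G - E` obtained by deleting the edges in `E` (and no vertices). -/
def deleteEdgeSet (G : SimpleGraph V) (E : Finset (Sym2 V)) : SimpleGraph V :=
  G.deleteEdges (E : Set (Sym2 V))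

/-- The subgraph `Ė` of `G` induced by a set `E` of edges of `G`: its edges are those in `E`, its
vertices are the ends of these edges. -/
def edgeSpan (G : SimpleGraph V) (E : Finset (Sym2 V)) : G.Subgraph where
  verts := {v | ∃ w, G.Adj v w ∧ s(v, w) ∈ E}
  Adj v w := G.Adj v w ∧ s(v, w) ∈ E
  adj_sub h := h.1
  edge_vert h := ⟨_, h⟩
  symm := ⟨fun v w h => ⟨h.1.symm, by rw [Sym2.eq_swap]; exact h.2⟩⟩

/-- `Ė` is a claw, i.e. isomorphic to `K_{1,3}`. -/
def SpansClaw (G : SimpleGraph V) (E : Finset (Sym2 V)) : Prop :=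
  Nonempty ((edgeSpan G E).coe ≃g completeBipartiteGraph (Fin 1) (Fin 3))

/-- `Ė` is a triangle. -/
def SpansTriangle (G : SimpleGraph V) (E : Finset (Sym2 V)) : Prop :=
  Nonempty ((edgeSpan G E).coe ≃g (⊤ : SimpleGraph (Fin 3)))

/-- `Ė` has exactly two components, namely a 2-edge component with edge set `E₂` and a 1-edge
component with edge set `E₁`. -/
def HasTwoComponents (G : SimpleGraph V) (E E₂ E₁ : Finset (Sym2 V)) : Prop :=
  (E : Set (Sym2 V)) = (E₂ : Set (Sym2 V)) ∪ (E₁ : Set (Sym2 V)) ∧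
  E₂.card = 2 ∧ E₁.card = 1 ∧
  (edgeSpan G E₂).Connected ∧ (edgeSpan G E₁).Connected ∧
  Disjoint (edgeSpan G E₂).verts (edgeSpan G E₁).verts

/-- All the edges in `E` belong to the triangle with vertex set `T`. -/
def InTriangle (E : Finset (Sym2 V)) (T : Finset V) : Prop :=
  ∀ e ∈ E, ∀ v ∈ e, v ∈ T

/-- `Ė` has exactly two components, the 2-edge component belongs to a triangle of `G`, the 1-edge
component belongs to no triangle of `G`, and `G - E` is not connected. -/
def ConditionE3 (G : SimpleGraph V) (E : Finset (Sym2 V)) : Prop :=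
  ∃ E₂ E₁ : Finset (Sym2 V), HasTwoComponents G E E₂ E₁ ∧
    (∃ T, IsTriangle G T ∧ InTriangle E₂ T) ∧
    (¬ ∃ D, IsTriangle G D ∧ InTriangle E₁ D) ∧
    ¬ (deleteEdgeSet G E).Connected

/-- `Ė` has exactly two components, the 2-edge component `Ė₂` belongs to a triangle `T` of `G`, the
1-edge component `Ė₁` belongs to a triangle `D` of `G`, and `Ė₁`, `Ė₂` belong to different
components of `G - {d, t}`. Here `w` is the vertex of `D - Ė₁` and `d` is the edge outside `D`
incident to `w`; `z` is the isolated vertex of `T - E` and `t` is the edge of `G - E` incident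
to `z`. -/
def ConditionE4 (G : SimpleGraph V) (E : Finset (Sym2 V)) : Prop :=
  ∃ E₂ E₁ : Finset (Sym2 V), HasTwoComponents G E E₂ E₁ ∧
    ∃ T D : Finset V, IsTriangle G T ∧ InTriangle E₂ T ∧ IsTriangle G D ∧ InTriangle E₁ D ∧
      ∃ w ∈ D, w ∉ (edgeSpan G E₁).verts ∧
      ∃ d ∈ G.edgeSet, w ∈ d ∧ (¬ ∀ v ∈ d, v ∈ D) ∧
      ∃ z ∈ T, (∀ u ∈ T, u ≠ z → s(z, u) ∈ E) ∧
      ∃ t ∈ (deleteEdgeSet G E).edgeSet, z ∈ t ∧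
      ∃ C₁ C₂ : (G.deleteEdges {d, t}).ConnectedComponent, C₁ ≠ C₂ ∧
        (edgeSpan G E₁).verts ⊆ C₁.supp ∧ (edgeSpan G E₂).verts ⊆ C₂.supp

end LambdaFactor

/-! Contract the triangles of `G`: the edges joining each vertex `v` to its neighbour `mate v`
outside its triangle form a cubic multigraph. A Λ-factor of a subgraph of `G` is encoded by the map
`c` to middle vertices. Two middles in one triangle would need six vertices out of five, and there
are as many middles as triangles, so each triangle holds exactly one. Hence every union of triangles
sends out as many leaves as it receives (`card_filter_centre_eq`): the leaves with middle in another
triangle trace disjoint directed cycles of the multigraph. Conversely, such cycles, recorded by the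
set `O` of vertices where they leave a triangle, give a Λ-factor (`IsOutSet.exists_centreMap`): a
triangle entered at `a` and left at `b` carries the path `mate a`, `a`, third vertex, and a triangle
off the cycles carries a path of its own.

If no triangle loses two edges, the empty family of cycles works. If a triangle loses both edges at
`z`, then in any Λ-factor `z`, unless isolated, is a leaf of `mate z`, so a cycle must leave through
`z`. The third deleted edge restricts it: an edge between triangles may not be used, while an edge
`pq` of a triangle `{r, p, q}` forbids leaving that triangle at `r`. Either a suitable cycle exists
or an edge cut blocks it; since 2-connectedness gives at least two edges in every cut around a union
of triangles (`exists_two_boundary`), the blocking cuts are those of (e3) and (e4).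

For (B), a triangle of `F^Δ` cannot contain a dart and its reverse, and connectedness is lifted from
`F` minus a vertex. -/

namespace LambdaFactor

variable {V : Type*}

open Finset

/-! ### Centre maps of `Λ`-factors -/

/-- `c` sends every vertex to the middle vertex of its path in a `Λ`-factor of `G`. -/
structure IsCentreMap [Fintype V] [DecidableEq V] (G : SimpleGraph V) (c : V → V) : Prop where
  idem : ∀ v, c (c v) = c v
  adj : ∀ v, c v ≠ v → G.Adj v (c v)
  card_fibre : ∀ v, #{x | c x = c v} = 3

/-- The union of the paths described by a centre map. -/
def centreGraph (c : V → V) : SimpleGraph V where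
  Adj a b := a ≠ b ∧ c a = c b ∧ (c a = a ∨ c b = b)
  symm := ⟨fun _ _ h => ⟨h.1.symm, h.2.1.symm, h.2.2.symm⟩⟩
  loopless := ⟨fun _ h => h.1 rfl⟩

theorem HasLambdaFactor.exists_centreMap [Fintype V] [DecidableEq V] {G : SimpleGraph V}
    (h : HasLambdaFactor G) : ∃ c, IsCentreMap G c := by
  classical
  obtain ⟨H, hH, hC⟩ := h
  let φ := fun C => (hC C).some
  let c : V → V := fun v => ((φ (H.connectedComponentMk v)).symm 1).1
  have hmk : ∀ v, H.connectedComponentMk (c v) = H.connectedComponentMk v := fun v =>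
    ((φ (H.connectedComponentMk v)).symm 1).2
  have hval : ∀ v w, H.connectedComponentMk v = H.connectedComponentMk w → c v = c w := by
    intro v w hvw
    simp only [c]
    rw [hvw]
  refine ⟨c, fun v => hval _ _ (hmk v), fun v hv => ?_, fun v => ?_⟩
  · apply hH
    set C := H.connectedComponentMk v with hCdef
    have hvC : v ∈ C.supp := rfl
    have h1 : φ C ⟨v, hvC⟩ ≠ 1 := by
      intro h1
      apply hv
      have : (φ C).symm 1 = ⟨v, hvC⟩ := by rw [← h1, RelIso.symm_apply_apply]
      change ((φ C).symm 1).1 = v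
      rw [this]
    have h2 : ∀ i : Fin 3, i ≠ 1 → (SimpleGraph.pathGraph 3).Adj i 1 := by
      intro i hi
      rw [SimpleGraph.pathGraph_adj]
      fin_cases i <;> simp_all
    have h3 := h2 _ h1
    have h4 : (H.induce C.supp).Adj ⟨v, hvC⟩ ((φ C).symm 1) := by
      rw [← (φ C).map_rel_iff]
      simpa using h3
    exact h4
  · set C := H.connectedComponentMk v with hCdef
    have h1 : ({x | c x = c v} : Finset V) = C.supp.toFinset := by
      ext x
      simp only [mem_filter, mem_univ, true_and, Set.mem_toFinset,
        SimpleGraph.ConnectedComponent.mem_supp_iff]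
      refine ⟨fun hx => ?_, fun hx => hval _ _ hx⟩
      rw [← hmk x, hx, hmk v]
    rw [h1, Set.toFinset_card, Fintype.card_congr (φ C).toEquiv, Fintype.card_fin]

/-- Every vertex equals or is adjacent to its centre, so the components of `centreGraph c` are the
fibres of `c`; a fibre `{a, x, b}` with centre `x` is the path `a`, `x`, `b`. -/
theorem IsCentreMap.hasLambdaFactor [Fintype V] [DecidableEq V] {G : SimpleGraph V} {c : V → V}
    (h : IsCentreMap G c) : HasLambdaFactor G := by
  classical
  refine ⟨centreGraph c, ?_, fun C => ?_⟩
  · rintro a b ⟨hab, hc, ha | hb⟩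
    · have := h.adj b (by rw [← hc, ha]; exact hab)
      rw [← hc, ha] at this
      exact this.symm
    · have := h.adj a (by rw [hc, hb]; exact hab.symm)
      rwa [hc, hb] at this
  have hreach : ∀ a b, (centreGraph c).Reachable a b → c a = c b := by
    rintro a b ⟨p⟩
    induction p with
    | nil => rfl
    | cons hadj _ ih => exact hadj.2.1.trans ih
  induction C using SimpleGraph.ConnectedComponent.ind with | _ v
  set C := (centreGraph c).connectedComponentMk v
  have hcen : ∀ a, (centreGraph c).Reachable a (c a) := by
    intro a
    by_cases ha : c a = a
    · rw [ha]
    · exact SimpleGraph.Adj.reachable ⟨Ne.symm ha, (h.idem a).symm, Or.inr (h.idem a)⟩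
  have hmem : ∀ a, a ∈ C.supp ↔ c a = c v := by
    intro a
    rw [SimpleGraph.ConnectedComponent.mem_supp_iff, SimpleGraph.ConnectedComponent.eq]
    refine ⟨hreach _ _, fun hav => (hcen a).trans ?_⟩
    rw [hav]
    exact (hcen v).symm
  set x := c v
  have hx : c x = x := h.idem v
  have hxm : x ∈ ({y | c y = x} : Finset V) := by simp [hx]
  have hcard : #(({y | c y = x} : Finset V).erase x) = 2 := by
    rw [card_erase_of_mem hxm, h.card_fibre v]
  obtain ⟨a, b, hab, habs⟩ := card_eq_two.1 hcard
  have hf : ∀ y, c y = x ↔ y = a ∨ y = x ∨ y = b := by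
    intro y
    have := congrArg (y ∈ ·) habs
    simp only [mem_erase, mem_filter, mem_univ, true_and, mem_insert, mem_singleton, eq_iff_iff]
      at this
    by_cases hy : y = x
    · simp [hy, hx]
    · simp only [hy, ne_eq, not_false_eq_true, true_and, false_or] at this ⊢
      exact this
  have hax : a ≠ x := by
    have : a ∈ (({y | c y = x} : Finset V).erase x) := by simp [habs]
    exact (mem_erase.1 this).1
  have hbx : b ≠ x := by
    have : b ∈ (({y | c y = x} : Finset V).erase x) := by simp [habs]
    exact (mem_erase.1 this).1
  have hca : c a = x := (hf a).2 (by simp)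
  have hcb : c b = x := (hf b).2 (by simp)
  let f : Fin 3 → C.supp := ![⟨a, (hmem a).2 hca⟩, ⟨x, (hmem x).2 hx⟩, ⟨b, (hmem b).2 hcb⟩]
  have hbij : Function.Bijective f := by
    constructor
    · intro i j hij
      fin_cases i <;> fin_cases j <;>
        simp [f, hab, hax, hbx, hab.symm, hax.symm, hbx.symm] at hij ⊢
    · rintro ⟨y, hy⟩
      rcases (hf y).1 ((hmem y).1 hy) with rfl | rfl | rfl
      · exact ⟨0, rfl⟩
      · exact ⟨1, rfl⟩
      · exact ⟨2, rfl⟩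
  refine ⟨RelIso.symm ⟨Equiv.ofBijective f hbij, ?_⟩⟩
  intro i j
  change (centreGraph c).Adj (f i).1 (f j).1 ↔ _
  rw [SimpleGraph.pathGraph_adj]
  fin_cases i <;> fin_cases j <;>
    simp [f, centreGraph, hca, hcb, hx, hab, hax, hbx, hab.symm, hax.symm, hbx.symm]

/-! ### Closed sets and connectivity -/

theorem exists_adj_of_preconnected {H : SimpleGraph V} (h : H.Preconnected) (S : Set V) {x y : V}
    (hx : x ∈ S) (hy : y ∉ S) : ∃ a ∈ S, ∃ b, b ∉ S ∧ H.Adj a b := by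
  obtain ⟨p⟩ := h x y
  obtain ⟨d, -, h1, h2⟩ := p.exists_boundary_dart S hx hy
  exact ⟨_, h1, _, h2, d.adj⟩

/-- Used mostly in contrapositive form: when no path exists, a set closed under adjacency separates
the two vertices. -/
theorem reachable_of_forall_closed {H : SimpleGraph V} {x y : V}
    (h : ∀ S : Set V, (∀ a ∈ S, ∀ b, H.Adj a b → b ∈ S) → x ∈ S → y ∈ S) : H.Reachable x y :=
  h {z | H.Reachable x z} (fun _ ha _ hab => ha.trans hab.reachable) (SimpleGraph.Reachable.refl x)

theorem connected_of_forall_closed {H : SimpleGraph V} (x : V)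
    (h : ∀ S : Set V, (∀ a ∈ S, ∀ b, H.Adj a b → b ∈ S) → x ∈ S → ∀ y, y ∈ S) : H.Connected := by
  rw [SimpleGraph.connected_iff_exists_forall_reachable]
  exact ⟨x, fun y => reachable_of_forall_closed fun S hS hx => h S hS hx y⟩

/-! ### Graphs in which the triangles partition the vertices -/

/-- A cubic graph presented by the triangle `tri v` through each vertex `v` and the third
neighbour `mate v` of `v`. -/
structure TriangleMatching (G : SimpleGraph V) where
  tri : V → Finset V
  mate : V → V
  mem_tri : ∀ v, v ∈ tri v
  tri_eq : ∀ {v w}, w ∈ tri v → tri w = tri v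
  card_tri : ∀ v, #(tri v) = 3
  mate_mate : ∀ v, mate (mate v) = v
  mate_notMem : ∀ v, mate v ∉ tri v
  adj_iff : ∀ {v w}, G.Adj v w ↔ (v ≠ w ∧ w ∈ tri v) ∨ w = mate v
  isTriangle_tri : ∀ v, IsTriangle G (tri v)
  eq_tri : ∀ {T v}, IsTriangle G T → v ∈ T → T = tri v

/-- Two of the three neighbours of `v` lie in its triangle; the remaining one is `mate v`. It is an
involution because `v` is adjacent to `mate v` but lies in a different triangle. -/
theorem exists_triangleMatching [Finite V] {G : SimpleGraph V} (hc : IsCubic G)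
    (hu : UniqueTriangles G) : Nonempty (TriangleMatching G) := by
  classical
  choose tri htri huniq using hu
  have heq : ∀ {v w}, w ∈ tri v → tri v = tri w := fun {v w} hw =>
    huniq w (tri v) ⟨(htri v).1, hw⟩
  have hadj : ∀ {v w}, w ∈ tri v → v ≠ w → G.Adj v w := fun {v w} hw hvw =>
    (htri v).1.1 (htri v).2 hw hvw
  have hm : ∀ v, ∃ m, m ∉ tri v ∧ ∀ w, G.Adj v w ↔ (v ≠ w ∧ w ∈ tri v) ∨ w = m := by
    intro v
    have hsub : (((tri v).erase v : Finset V) : Set V) ⊆ G.neighborSet v := by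
      intro w hw
      rw [mem_coe, mem_erase] at hw
      exact hadj hw.2 hw.1.symm
    have hcard : (G.neighborSet v \ (((tri v).erase v : Finset V) : Set V)).ncard = 1 := by
      rw [Set.ncard_sdiff hsub, hc v, Set.ncard_coe_finset, card_erase_of_mem (htri v).2,
        (htri v).1.2]
    obtain ⟨m, hm⟩ := Set.ncard_eq_one.1 hcard
    have hm' : ∀ w, (G.Adj v w ∧ ¬ (w ≠ v ∧ w ∈ tri v)) ↔ w = m := by
      intro w
      have := congrArg (w ∈ ·) hm
      simpa only [Set.mem_sdiff, SimpleGraph.mem_neighborSet, mem_coe, mem_erase,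
        Set.mem_singleton_iff, eq_iff_iff] using this
    have hmm := (hm' m).2 rfl
    refine ⟨m, fun h => hmm.2 ⟨hmm.1.ne', h⟩, fun w => ⟨fun h => ?_, ?_⟩⟩
    · by_cases hw : w ≠ v ∧ w ∈ tri v
      · exact Or.inl ⟨hw.1.symm, hw.2⟩
      · exact Or.inr ((hm' w).1 ⟨h, hw⟩)
    · rintro (h | rfl)
      · exact hadj h.2 h.1
      · exact hmm.1
  choose mate hmate hmadj using hm
  refine ⟨⟨tri, mate, fun v => (htri v).2, fun h => (heq h).symm, fun v => (htri v).1.2, fun v => ?_,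
    hmate, fun {v w} => hmadj v w, fun v => (htri v).1, fun {T v} hT hv => huniq v T ⟨hT, hv⟩⟩⟩
  have h1 : G.Adj (mate v) v := ((hmadj v (mate v)).2 (Or.inr rfl)).symm
  rcases (hmadj _ _).1 h1 with h | h
  · exact absurd (by rw [← heq h.2]; exact (htri _).2) (hmate v)
  · exact h.symm

namespace TriangleMatching

variable {G : SimpleGraph V} (M : TriangleMatching G)

theorem adj_mate (v : V) : G.Adj v (M.mate v) := M.adj_iff.2 (Or.inr rfl)

theorem adj_of_mem {v w : V} (h : w ∈ M.tri v) (hvw : v ≠ w) : G.Adj v w :=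
  M.adj_iff.2 (Or.inl ⟨hvw, h⟩)

theorem mem_comm {v w : V} (h : w ∈ M.tri v) : v ∈ M.tri w := by
  rw [M.tri_eq h]; exact M.mem_tri v

theorem mate_ne (v : V) : M.mate v ≠ v := (M.adj_mate v).ne'

theorem mate_inj {v w : V} (h : M.mate v = M.mate w) : v = w := by
  rw [← M.mate_mate v, h, M.mate_mate]

theorem mate_ne_of_mem {v w : V} (h : w ∈ M.tri v) : M.mate v ≠ w :=
  fun h' => M.mate_notMem v (h' ▸ h)

/-- A set of vertices that is a union of triangles. -/
def Closed (S : Finset V) : Prop := ∀ v ∈ S, ∀ w ∈ M.tri v, w ∈ S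

variable {M} in
theorem Closed.compl [Fintype V] [DecidableEq V] {S : Finset V} (hS : M.Closed S) :
    M.Closed Sᶜ := by
  intro v hv w hw
  rw [mem_compl] at hv ⊢
  exact fun h => hv (hS w h v (M.mem_comm hw))

theorem closed_tri (x : V) : M.Closed (M.tri x) := by
  intro v hv w hw
  rwa [← M.tri_eq hv]

theorem exists_tri_eq [DecidableEq V] (z : V) : ∃ u w, z ≠ u ∧ z ≠ w ∧ u ≠ w ∧
    M.tri z = {z, u, w} := by
  have h : #((M.tri z).erase z) = 2 := by
    rw [card_erase_of_mem (M.mem_tri z), M.card_tri]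
  obtain ⟨u, w, huw, h2⟩ := card_eq_two.1 h
  have hz : z ∉ (M.tri z).erase z := notMem_erase _ _
  rw [h2] at hz
  simp only [mem_insert, mem_singleton, not_or] at hz
  refine ⟨u, w, hz.1, hz.2, huw, ?_⟩
  rw [← insert_erase (M.mem_tri z), h2]

theorem tri_eq_of_mem [DecidableEq V] {z u w : V} (hu : u ∈ M.tri z) (hw : w ∈ M.tri z)
    (hzu : z ≠ u) (hzw : z ≠ w) (huw : u ≠ w) : M.tri z = {z, u, w} := by
  symm
  apply eq_of_subset_of_card_le
  · intro x hx
    simp only [mem_insert, mem_singleton] at hx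
    rcases hx with rfl | rfl | rfl
    exacts [M.mem_tri _, hu, hw]
  · rw [M.card_tri, card_eq_three.2 ⟨z, u, w, hzu, hzw, huw, rfl⟩]

/-- A nonempty proper union of triangles has two vertices whose mates lie outside. -/
theorem exists_two_boundary [DecidableEq V] (h2 : IsTwoConnected G) {S : Finset V}
    (hS : M.Closed S) {x y : V} (hx : x ∈ S) (hy : y ∉ S) :
    ∃ a ∈ S, ∃ b ∈ S, a ≠ b ∧ M.mate a ∉ S ∧ M.mate b ∉ S := by
  have key : ∀ a ∈ S, ∀ b, b ∉ S → G.Adj a b → b = M.mate a := by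
    intro a ha b hb hab
    rcases M.adj_iff.1 hab with h | h
    · exact absurd (hS a ha b h.2) hb
    · exact h
  obtain ⟨a, ha, a', ha', hadj⟩ := exists_adj_of_preconnected h2.2.1.preconnected (S : Set V)
    (mem_coe.2 hx) (fun h => hy (mem_coe.1 h))
  have e1 := key a ha a' ha' hadj
  obtain ⟨u, w, hau, -, -, htri⟩ := M.exists_tri_eq a
  have huS : u ∈ S := hS a ha u (by rw [htri]; simp)
  have hya : a' ≠ a := hadj.ne'
  -- Deleting `a` leaves `u` of the same triangle inside `S` and `a'` outside, so a second crossing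
  -- edge starts at some `b ≠ a`.
  obtain ⟨⟨b, hba⟩, hb, ⟨b', hba'⟩, hb', hadj'⟩ := exists_adj_of_preconnected
    (h2.2.2 a).preconnected {v | v.1 ∈ S} (x := ⟨u, by simpa using hau.symm⟩)
    (y := ⟨a', by simpa using hya⟩) huS ha'
  have e2 := key b hb b' hb' hadj'
  refine ⟨a, ha, b, hb, ?_, e1 ▸ ha', e2 ▸ hb'⟩
  rintro rfl
  simp at hba

/-! ### Centre maps and unions of triangles -/

section Centre

variable [Fintype V] [DecidableEq V] {G' : SimpleGraph V} {c : V → V}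

/-- The centres lying in a union `S` of triangles. -/
theorem card_filter_centre (hc : IsCentreMap G' c) (S : Finset V) :
    #{v | c v ∈ S} = 3 * #{x ∈ S | c x = x} := by
  have h1 : ∀ v ∈ ({v | c v ∈ S} : Finset V), c v ∈ ({x ∈ S | c x = x} : Finset V) := by
    intro v hv
    simp only [mem_filter, mem_univ, true_and] at hv ⊢
    exact ⟨hv, hc.idem v⟩
  rw [card_eq_sum_card_fiberwise h1, sum_const_nat (m := 3), mul_comm]
  intro x hx
  rw [mem_filter] at hx
  rw [← hc.card_fibre x, hx.2]
  congr 1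
  ext v
  simp only [mem_filter, mem_univ, true_and, and_iff_right_iff_imp]
  rintro rfl
  exact hx.1

/-- The disjoint fibres of two centres in one triangle would have six vertices, all among the
triangle and the two mates, which are only five. -/
theorem centre_unique (hG : G' ≤ G) (hc : IsCentreMap G' c) {a b : V} (hb : b ∈ M.tri a)
    (ha : c a = a) (hb' : c b = b) : a = b := by
  by_contra hab
  obtain ⟨d, hda⟩ : ∃ d, M.tri a = {a, b, d} := by
    obtain ⟨u, w, h1, h2, h3, h4⟩ := M.exists_tri_eq a
    rw [h4] at hb ⊢
    simp only [mem_insert, mem_singleton] at hb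
    rcases hb with rfl | rfl | rfl
    · exact absurd rfl hab
    · exact ⟨w, rfl⟩
    · exact ⟨u, by ext; simp; tauto⟩
  have hfib : ∀ x, c x = a ∨ c x = b → x ∈ ({a, b, d, M.mate a, M.mate b} : Finset V) := by
    intro x hx
    simp only [mem_insert, mem_singleton]
    by_cases hxc : c x = x
    · rw [hxc] at hx
      tauto
    · have hadj := (hG (hc.adj x hxc)).symm
      rcases hx with hx | hx
      · rw [hx] at hadj
        rcases M.adj_iff.1 hadj with h | h
        · have := h.2
          rw [hda] at this
          simp only [mem_insert, mem_singleton] at this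
          tauto
        · tauto
      · rw [hx] at hadj
        rcases M.adj_iff.1 hadj with h | h
        · have := h.2
          rw [M.tri_eq hb, hda] at this
          simp only [mem_insert, mem_singleton] at this
          tauto
        · tauto
  have hdisj : Disjoint ({x | c x = a} : Finset V) ({x | c x = b} : Finset V) := by
    rw [disjoint_left]
    intro x h1 h2
    simp only [mem_filter, mem_univ, true_and] at h1 h2
    exact hab (h1.symm.trans h2)
  have h1 := hc.card_fibre a
  have h2 := hc.card_fibre b
  rw [ha] at h1
  rw [hb'] at h2
  have h3 := card_union_of_disjoint hdisj
  have h4 : #(({x | c x = a} : Finset V) ∪ ({x | c x = b} : Finset V)) ≤ 5 := by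
    refine (card_le_card ?_).trans (card_le_five (a := a) (b := b) (c := d) (d := M.mate a)
      (e := M.mate b))
    intro x hx
    apply hfib
    simpa using hx
  omega

/-- Distinct centres in `S` have disjoint triangles, all contained in `S`, and each centre accounts
for three vertices on the left. -/
theorem card_filter_centre_le (hG : G' ≤ G) (hc : IsCentreMap G' c) {S : Finset V}
    (hS : M.Closed S) : #{v | c v ∈ S} ≤ #S := by
  rw [card_filter_centre hc, mul_comm]
  have hdisj : Set.PairwiseDisjoint (({x ∈ S | c x = x} : Finset V) : Set V) M.tri := by
    intro a ha b hb hab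
    simp only [coe_filter, Set.mem_ofPred_eq] at ha hb
    change Disjoint _ _
    rw [disjoint_left]
    intro x hxa hxb
    apply hab
    apply M.centre_unique hG hc _ ha.2 hb.2
    rw [← M.tri_eq hxa, M.tri_eq hxb]
    exact M.mem_tri b
  rw [← sum_const_nat (fun x _ => M.card_tri x), ← card_biUnion hdisj]
  apply card_le_card
  intro x hx
  simp only [mem_biUnion, mem_filter] at hx
  obtain ⟨a, ha, hxa⟩ := hx
  exact hS a ha.1 x hxa

/-- A union of triangles is left by as many paths' leaves as it receives. -/
theorem card_filter_centre_eq (hG : G' ≤ G) (hc : IsCentreMap G' c) {S : Finset V}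
    (hS : M.Closed S) : #{v | c v ∈ S} = #S := by
  have h1 := M.card_filter_centre_le hG hc hS
  -- The bounds for `S` and its complement have equal sums on both sides, so both are equalities.
  have h2 := M.card_filter_centre_le hG hc hS.compl
  have h3 := card_filter_add_card_filter_not (s := (univ : Finset V)) (fun v => c v ∈ S)
  have h4 := card_add_card_compl S
  simp only [mem_compl] at h2
  rw [card_univ] at h3
  omega

/-- If some vertex outside a union `S` of triangles has its centre in `S`, then some vertex of `S`
has its centre outside. -/
theorem exists_leaving (hG : G' ≤ G) (hc : IsCentreMap G' c) {S : Finset V} (hS : M.Closed S)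
    {x : V} (hx : x ∉ S) (hcx : c x ∈ S) : ∃ y ∈ S, c y ∉ S := by
  by_contra! h
  have h1 : insert x S ⊆ ({v | c v ∈ S} : Finset V) := by
    intro y hy
    rw [mem_insert] at hy
    simp only [mem_filter, mem_univ, true_and]
    rcases hy with rfl | hy
    exacts [hcx, h y hy]
  have h2 := card_le_card h1
  rw [M.card_filter_centre_eq hG hc hS, card_insert_of_notMem hx] at h2
  omega

theorem exists_centre_mem (hG : G' ≤ G) (hc : IsCentreMap G' c) (x : V) :
    ∃ y ∈ M.tri x, c y = y := by
  have h := M.card_filter_centre_eq hG hc (M.closed_tri x)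
  rw [M.card_tri, card_filter_centre hc] at h
  have h1 : 0 < #{y ∈ M.tri x | c y = y} := by omega
  obtain ⟨y, hy⟩ := card_pos.1 h1
  rw [mem_filter] at hy
  exact ⟨y, hy⟩

theorem exists_entering (hG : G' ≤ G) (hc : IsCentreMap G' c) {S : Finset V} (hS : M.Closed S)
    {x : V} (hx : x ∈ S) (hcx : c x ∉ S) : ∃ y, y ∉ S ∧ c y ∈ S := by
  obtain ⟨y, hy, hy'⟩ := M.exists_leaving hG hc hS.compl (x := x) (by simpa using hx)
    (by simpa using hcx)
  exact ⟨y, by simpa using hy, by simpa using hy'⟩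

theorem exists_adj_ne_of_centre (hc : IsCentreMap G' c) {x : V} (hx : c x = x) (y : V) :
    ∃ w, w ≠ y ∧ w ≠ x ∧ c w = x ∧ G'.Adj x w := by
  have h1 := hc.card_fibre x
  rw [hx] at h1
  have h2 : 0 < #((({w | c w = x} : Finset V).erase y).erase x) := by
    have := pred_card_le_card_erase (s := ({w | c w = x} : Finset V)) (a := y)
    have := pred_card_le_card_erase (s := ({w | c w = x} : Finset V).erase y) (a := x)
    omega
  obtain ⟨w, hw⟩ := card_pos.1 h2
  simp only [mem_erase, mem_filter, mem_univ, true_and] at hw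
  refine ⟨w, hw.2.1, hw.1, hw.2.2, ?_⟩
  have := hc.adj w (by rw [hw.2.2]; exact hw.1.symm)
  rw [hw.2.2] at this
  exact this.symm

/-- A vertex all of whose neighbours equal its mate is a leaf joined to its mate. -/
theorem centre_eq_mate (hc : IsCentreMap G' c) {z : V} (hz : ∀ w, G'.Adj z w → w = M.mate z) :
    c z = M.mate z := by
  by_cases h : c z = z
  · obtain ⟨w, hw, -, -, hadj⟩ := exists_adj_ne_of_centre hc h (M.mate z)
    exact absurd (hz w hadj) hw
  · exact hz _ (hc.adj z h)

end Centre

end TriangleMatching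

theorem deleteEdgeSet_adj {G : SimpleGraph V} {E : Finset (Sym2 V)} {v w : V} :
    (deleteEdgeSet G E).Adj v w ↔ G.Adj v w ∧ s(v, w) ∉ E := by
  simp [deleteEdgeSet, SimpleGraph.deleteEdges_adj]

theorem deleteEdgeSet_le (G : SimpleGraph V) (E : Finset (Sym2 V)) : deleteEdgeSet G E ≤ G :=
  SimpleGraph.deleteEdges_le _

namespace TriangleMatching

variable {G : SimpleGraph V} (M : TriangleMatching G)

theorem eq_mate_of_adj_deleteEdgeSet [DecidableEq V] {E : Finset (Sym2 V)} {z u w x : V}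
    (htri : M.tri z = {z, u, w}) (hu : s(z, u) ∈ E) (hw : s(z, w) ∈ E)
    (h : (deleteEdgeSet G E).Adj z x) : x = M.mate z := by
  rw [deleteEdgeSet_adj] at h
  rcases M.adj_iff.1 h.1 with h' | h'
  · have := h'.2
    rw [htri] at this
    simp only [mem_insert, mem_singleton] at this
    rcases this with rfl | rfl | rfl
    exacts [absurd rfl h'.1, absurd hu h.2, absurd hw h.2]
  · exact h'

/-! ### Edge sets whose deletion destroys all `Λ`-factors -/

section Obstruction

variable [Fintype V] [DecidableEq V] {E : Finset (Sym2 V)} {c : V → V}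

theorem not_spansClaw (hG : IsCubic G) (hc : IsCentreMap (deleteEdgeSet G E) c) :
    ¬ SpansClaw G E := by
  rintro ⟨φ⟩
  set z := φ.symm (Sum.inl 0)
  have hadj : ∀ i : Fin 3, (edgeSpan G E).Adj z.1 (φ.symm (Sum.inr i)).1 := by
    intro i
    have : (edgeSpan G E).coe.Adj z (φ.symm (Sum.inr i)) := by
      rw [φ.symm.map_rel_iff]
      simp
    exact this
  have hinj : Function.Injective fun i : Fin 3 => (φ.symm (Sum.inr i)).1 := by
    intro i j hij
    have := φ.symm.injective (Subtype.ext hij)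
    simpa using this
  have hsub : Set.range (fun i : Fin 3 => (φ.symm (Sum.inr i)).1) = G.neighborSet z.1 := by
    apply Set.eq_of_subset_of_ncard_le
    · rintro _ ⟨i, rfl⟩
      exact (hadj i).1
    · rw [hG, ← Set.image_univ, Set.ncard_image_of_injective _ hinj, Set.ncard_univ]
      simp
    · exact Set.toFinite _
  have hiso : ∀ w, ¬ (deleteEdgeSet G E).Adj z.1 w := by
    intro w hw
    rw [deleteEdgeSet_adj] at hw
    have : w ∈ G.neighborSet z.1 := hw.1
    rw [← hsub] at this
    obtain ⟨i, rfl⟩ := this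
    exact hw.2 (hadj i).2
  by_cases h : c z.1 = z.1
  · obtain ⟨w, -, -, -, hw⟩ := exists_adj_ne_of_centre hc h z.1
    exact hiso w hw
  · exact hiso _ (hc.adj _ h)

-- Each vertex of the triangle keeps only its mate as a neighbour, hence is a leaf; but every
-- triangle contains a centre.
include M in
theorem not_spansTriangle (hc : IsCentreMap (deleteEdgeSet G E) c) : ¬ SpansTriangle G E := by
  rintro ⟨φ⟩
  let a : Fin 3 → V := fun i => (φ.symm i).1
  have hadj : ∀ i j, i ≠ j → G.Adj (a i) (a j) ∧ s(a i, a j) ∈ E := by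
    intro i j hij
    have : (edgeSpan G E).coe.Adj (φ.symm i) (φ.symm j) := by
      rw [φ.symm.map_rel_iff]
      simpa using hij
    exact this
  have hT : IsTriangle G {a 0, a 1, a 2} := by
    rw [IsTriangle, SimpleGraph.is3Clique_triple_iff]
    exact ⟨(hadj 0 1 (by decide)).1, (hadj 0 2 (by decide)).1, (hadj 1 2 (by decide)).1⟩
  obtain ⟨y, hy, hyc⟩ := M.exists_centre_mem (deleteEdgeSet_le G E) hc (a 0)
  have hne : ∀ y ∈ M.tri (a 0), c y ≠ y := by
    have h0 := M.eq_tri hT (v := a 0) (by simp)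
    have h1 := M.eq_tri hT (v := a 1) (by simp)
    have h2 := M.eq_tri hT (v := a 2) (by simp)
    intro y hy
    rw [← h0] at hy
    simp only [mem_insert, mem_singleton] at hy
    have : c y = M.mate y := by
      apply M.centre_eq_mate hc
      intro x hx
      rcases hy with rfl | rfl | rfl
      · exact M.eq_mate_of_adj_deleteEdgeSet h0.symm (hadj 0 1 (by decide)).2
          (hadj 0 2 (by decide)).2 hx
      · exact M.eq_mate_of_adj_deleteEdgeSet (u := a 0) (w := a 2) (by rw [← h1]; ext; simp; tauto)
          (hadj 1 0 (by decide)).2 (hadj 1 2 (by decide)).2 hx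
      · exact M.eq_mate_of_adj_deleteEdgeSet (u := a 0) (w := a 1) (by rw [← h2]; ext; simp; tauto)
          (hadj 2 0 (by decide)).2 (hadj 2 1 (by decide)).2 hx
    rw [this]
    exact M.mate_ne y
  exact hne y hy hyc

/-- The core of (e3): were `G - E` disconnected, a closed set `S` around `z` would contradict either
the two-edge bound on cuts or the balance of leaves. -/
theorem connected_of_cross_edge (h2 : IsTwoConnected G) (hc : IsCentreMap (deleteEdgeSet G E) c)
    {z u w x : V} (hzu : z ≠ u) (hzw : z ≠ w) (huw : u ≠ w) (htri : M.tri z = {z, u, w})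
    (hE : E = {s(z, u), s(z, w), s(x, M.mate x)}) (hx : x ∉ M.tri z) (hmx : M.mate x ∉ M.tri z) :
    (deleteEdgeSet G E).Connected := by
  by_contra hcon
  obtain ⟨S, hS, hzS, y, hyS⟩ : ∃ S : Finset V,
      (∀ a ∈ S, ∀ b, (deleteEdgeSet G E).Adj a b → b ∈ S) ∧ z ∈ S ∧ ∃ y, y ∉ S := by
    by_contra! h
    apply hcon
    apply connected_of_forall_closed z
    intro S hS hz y
    classical
    have := h S.toFinset (fun a ha b hab => by
      rw [Set.mem_toFinset] at ha ⊢; exact hS a ha b hab) (by simpa using hz) y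
    simpa using this
  have hzx : z ≠ x := by
    rintro rfl; exact hx (M.mem_tri z)
  have hzmx : z ≠ M.mate x := fun h => hmx (h ▸ M.mem_tri z)
  have huT : u ∈ M.tri z := by simp [htri]
  have hwT : w ∈ M.tri z := by simp [htri]
  have hsame : ∀ {a b}, a ≠ b → b ∈ M.tri a → a ≠ z → b ≠ z →
      (deleteEdgeSet G E).Adj a b := by
    intro a b hab hb haz hbz
    rw [deleteEdgeSet_adj]
    refine ⟨M.adj_of_mem hb hab, ?_⟩
    rw [hE]
    simp only [mem_insert, mem_singleton, Sym2.eq_iff, not_or]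
    refine ⟨by tauto, by tauto, ?_, ?_⟩ <;> rintro ⟨rfl, rfl⟩
    · exact M.mate_notMem _ hb
    · exact M.mate_notMem _ (M.mem_comm hb)
  have hcross : ∀ a, a ≠ x → M.mate a ≠ x → (deleteEdgeSet G E).Adj a (M.mate a) := by
    intro a h1 h3
    rw [deleteEdgeSet_adj]
    refine ⟨M.adj_mate a, ?_⟩
    rw [hE]
    simp only [mem_insert, mem_singleton, Sym2.eq_iff, not_or, not_and]
    refine ⟨⟨?_, ?_⟩, ⟨?_, ?_⟩, ?_⟩
    · rintro rfl; exact M.mate_ne_of_mem huT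
    · rintro rfl h; exact M.mate_notMem a (h ▸ M.mem_comm huT)
    · rintro rfl; exact M.mate_ne_of_mem hwT
    · rintro rfl h; exact M.mate_notMem a (h ▸ M.mem_comm hwT)
    · tauto
  have hmz : M.mate z ∈ S := hS z hzS _ (hcross z hzx (fun h => hzmx (by rw [← h, M.mate_mate])))
  have hzS' : c z = M.mate z := M.centre_eq_mate hc fun y hy =>
    M.eq_mate_of_adj_deleteEdgeSet htri (by simp [hE]) (by simp [hE]) hy
  -- Here `S` is a union of triangles whose only crossing edge is the deleted one at `x`, against
  -- `exists_two_boundary`.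
  by_cases huS : u ∈ S
  · have hwS : w ∈ S := hS u huS w (hsame huw (by rw [M.tri_eq huT]; exact hwT) hzu.symm hzw.symm)
    have hcl : M.Closed S := by
      intro a ha b hb
      by_cases haz : a = z
      · subst haz
        rw [htri] at hb
        simp only [mem_insert, mem_singleton] at hb
        rcases hb with rfl | rfl | rfl <;> assumption
      · by_cases hbz : b = z
        · exact hbz ▸ hzS
        · by_cases hab : a = b
          · exact hab ▸ ha
          · exact hS a ha b (hsame hab hb haz hbz)
    obtain ⟨a, ha, b, hb, hab, hma, hmb⟩ := M.exists_two_boundary h2 hcl hzS hyS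
    have hxb : ∀ a ∈ S, M.mate a ∉ S → a = x ∨ M.mate a = x := by
      intro a ha hma
      by_contra! h
      exact hma (hS a ha _ (hcross a h.1 h.2))
    rcases hxb a ha hma with h1 | h1 <;> rcases hxb b hb hmb with h3 | h3
    · exact hab (h1.trans h3.symm)
    · exact hmb (by rw [h3, ← h1]; exact ha)
    · exact hma (by rw [h1, ← h3]; exact hb)
    · exact hab (M.mate_inj (h1.trans h3.symm))
  -- Now `S` without `z` is a union of triangles. It receives the leaf `z`, so some leaf leaves it;
  -- as `S` is closed, that leaf's centre can only be `z`, which is not a centre.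
  · have hwS : w ∉ S := fun h => huS (hS w h u
      (hsame huw.symm (by rw [M.tri_eq hwT]; exact huT) hzw.symm hzu.symm))
    have hcl : M.Closed (S.erase z) := by
      intro a ha b hb
      rw [mem_erase] at ha ⊢
      have hbz : b ≠ z := by
        rintro rfl
        have := M.mem_comm hb
        rw [htri] at this
        simp only [mem_insert, mem_singleton] at this
        rcases this with rfl | rfl | rfl
        exacts [ha.1 rfl, huS ha.2, hwS ha.2]
      refine ⟨hbz, ?_⟩
      by_cases hab : a = b
      · exact hab ▸ ha.2
      · exact hS a ha.2 b (hsame hab hb ha.1 hbz)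
    obtain ⟨v, hv, hcv⟩ := M.exists_leaving (deleteEdgeSet_le G E) hc hcl (x := z) (by simp)
      (by rw [hzS', mem_erase]; exact ⟨M.mate_ne z, hmz⟩)
    rw [mem_erase] at hv hcv
    have hadj : (deleteEdgeSet G E).Adj v (c v) := by
      apply hc.adj
      intro h
      rw [h] at hcv
      exact hcv hv
    have hcvS := hS v hv.2 _ hadj
    have hcvz : c v = z := by
      by_contra h
      exact hcv ⟨h, hcvS⟩
    have := hc.idem v
    rw [hcvz, hzS'] at this
    exact M.mate_ne z this

/-- The core of (e4): the leaf `z` leaves `S` through one edge of the cut, so balance forces the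
other edge to be used inwards, making `r` a leaf of `mate r`. The triangle of `r` then needs the
deleted edge `pq`. -/
theorem not_separated (h2 : IsTwoConnected G) (hc : IsCentreMap (deleteEdgeSet G E) c)
    {z u w r p q : V} (htri : M.tri z = {z, u, w}) (hu : s(z, u) ∈ E) (hw : s(z, w) ∈ E)
    (hrp : r ≠ p) (htri' : M.tri r = {r, p, q}) (hpq : s(p, q) ∈ E)
    {S : Finset V} (hS : M.Closed S) (hzS : z ∈ S) (hrS : r ∉ S)
    (hb : ∀ a ∈ S, M.mate a ∉ S → s(a, M.mate a) = s(r, M.mate r) ∨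
      s(a, M.mate a) = s(z, M.mate z)) : False := by
  have hcz : c z = M.mate z := M.centre_eq_mate hc fun y hy =>
    M.eq_mate_of_adj_deleteEdgeSet htri hu hw hy
  have hb' : ∀ a ∈ S, M.mate a ∉ S → M.mate a = r ∨ s(a, M.mate a) = s(z, M.mate z) := by
    intro a ha hma
    rcases hb a ha hma with h | h
    · rcases Sym2.eq_iff.1 h with ⟨rfl, -⟩ | ⟨-, h⟩
      · exact absurd ha hrS
      · exact Or.inl h
    · exact Or.inr h
  -- Otherwise only the edge at `r` crosses the boundary of `S`.
  have hmz : M.mate z ∉ S := by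
    intro hmz
    obtain ⟨a, ha, b, hb, hab, hma, hmb⟩ := M.exists_two_boundary h2 hS hzS hrS
    have h3 : ∀ a ∈ S, M.mate a ∉ S → M.mate a = r := by
      intro a ha hma
      rcases hb' a ha hma with h | h
      · exact h
      · rcases Sym2.eq_iff.1 h with ⟨-, h⟩ | ⟨-, h⟩
        · exact absurd (h ▸ hmz) hma
        · exact absurd (h ▸ hzS) hma
    exact hab (M.mate_inj ((h3 a ha hma).trans (h3 b hb hmb).symm))
  obtain ⟨v, hv, hcv⟩ := M.exists_entering (deleteEdgeSet_le G E) hc hS hzS (by rwa [hcz])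
  have hadj : G.Adj (c v) v := by
    refine (deleteEdgeSet_le G E (hc.adj v fun h => ?_)).symm
    rw [h] at hcv
    exact hv hcv
  have hvm : v = M.mate (c v) := by
    rcases M.adj_iff.1 hadj with h | h
    · exact absurd (hS _ hcv _ h.2) hv
    · exact h
  have hvr : v = r := by
    rcases hb' _ hcv (hvm ▸ hv) with h | h
    · rw [hvm, h]
    · rcases Sym2.eq_iff.1 h with ⟨h, -⟩ | ⟨h, -⟩
      · have := hc.idem v
        rw [h, hcz] at this
        exact absurd this (M.mate_ne z)
      · exact absurd (h ▸ hcv) hmz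
  subst hvr
  have hmv : c v = M.mate v := by
    conv_rhs => rw [hvm, M.mate_mate]
  -- The centre `y` of this triangle has a leaf `x` other than `mate y`, hence inside the triangle.
  -- Neither is `v`, whose centre is outside, so the edge `yx` is `pq`.
  obtain ⟨y, hy, hyc⟩ := M.exists_centre_mem (deleteEdgeSet_le G E) hc v
  have hcr : c v ∉ M.tri v := hmv ▸ M.mate_notMem v
  obtain ⟨x, hx1, hx2, hx3, hx4⟩ := exists_adj_ne_of_centre hc hyc (M.mate y)
  rw [deleteEdgeSet_adj] at hx4
  rcases M.adj_iff.1 hx4.1 with h | h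
  · have hxT := h.2
    rw [M.tri_eq hy, htri'] at hxT
    have hyT := hy
    rw [htri'] at hyT
    simp only [mem_insert, mem_singleton] at hxT hyT
    have hxv : x ≠ v := by
      rintro rfl
      exact hcr (hx3 ▸ hy)
    have hyv : y ≠ v := by
      rintro rfl
      exact hcr (hyc.symm ▸ M.mem_tri y)
    have h5 := hx4.2
    rcases hyT with rfl | rfl | rfl
    · exact hyv rfl
    · rcases hxT with rfl | rfl | rfl
      exacts [hxv rfl, hx2 rfl, h5 hpq]
    · rcases hxT with rfl | rfl | rfl
      exacts [hxv rfl, h5 (by rwa [Sym2.eq_swap]), hx2 rfl]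
  · exact hx1 h

end Obstruction

/-- Two edges of a triangle share a vertex. -/
theorem exists_eq_pair [DecidableEq V] {E₂ : Finset (Sym2 V)} {T : Finset V}
    (hT : IsTriangle G T) (hE : (E₂ : Set (Sym2 V)) ⊆ G.edgeSet) (hcard : #E₂ = 2)
    (hin : InTriangle E₂ T) : ∃ z u w, z ≠ u ∧ z ≠ w ∧ u ≠ w ∧ T = {z, u, w} ∧
      E₂ = {s(z, u), s(z, w)} := by
  obtain ⟨a, b, c, hab, hac, hbc, rfl⟩ := card_eq_three.1 hT.2
  have h1 : ∀ e ∈ E₂, e = s(a, b) ∨ e = s(a, c) ∨ e = s(b, c) := by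
    intro e he
    have hin' := hin e he
    have hne := hE he
    induction e with | _ x y
    have hx := hin' x (by simp)
    have hy := hin' y (by simp)
    have hxy : x ≠ y := G.ne_of_adj hne
    simp only [mem_insert, mem_singleton] at hx hy
    rcases hx with rfl | rfl | rfl <;> rcases hy with rfl | rfl | rfl <;> simp_all
  obtain ⟨e, f, hef, rfl⟩ := card_eq_two.1 hcard
  rcases h1 e (by simp) with rfl | rfl | rfl <;> rcases h1 f (by simp) with rfl | rfl | rfl
  · exact absurd rfl hef
  · exact ⟨a, b, c, hab, hac, hbc, rfl, rfl⟩
  · exact ⟨b, a, c, hab.symm, hbc, hac, by ext; simp; tauto, by rw [Sym2.eq_swap]⟩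
  · exact ⟨a, b, c, hab, hac, hbc, rfl, pair_comm _ _⟩
  · exact absurd rfl hef
  · exact ⟨c, a, b, hac.symm, hbc.symm, hab, by ext; simp; tauto, by
      rw [Sym2.eq_swap, Sym2.eq_swap (a := b)]⟩
  · exact ⟨b, a, c, hab.symm, hbc, hac, by ext; simp; tauto, by rw [pair_comm, Sym2.eq_swap]⟩
  · exact ⟨c, a, b, hac.symm, hbc.symm, hab, by ext; simp; tauto, by
      rw [pair_comm, Sym2.eq_swap, Sym2.eq_swap (a := b)]⟩
  · exact absurd rfl hef

/-! ### Conditions (e3) and (e4) exclude a Λ-factor. -/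

section Conditions

variable [Fintype V] [DecidableEq V] {E : Finset (Sym2 V)} {c : V → V}

include M in
theorem not_conditionE3 (h2 : IsTwoConnected G) (hE : (E : Set (Sym2 V)) ⊆ G.edgeSet)
    (hc : IsCentreMap (deleteEdgeSet G E) c) : ¬ ConditionE3 G E := by
  rintro ⟨E₂, E₁, ⟨hEE, h2c, h1c, -, -, hdisj⟩, ⟨T, hT, hin⟩, hout, hcon⟩
  have hsub2 : (E₂ : Set (Sym2 V)) ⊆ G.edgeSet :=
    (hEE ▸ Set.subset_union_left : (E₂ : Set (Sym2 V)) ⊆ E).trans hE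
  have hsub1 : (E₁ : Set (Sym2 V)) ⊆ G.edgeSet :=
    (hEE ▸ Set.subset_union_right : (E₁ : Set (Sym2 V)) ⊆ E).trans hE
  obtain ⟨z, u, w, hzu, hzw, huw, rfl, rfl⟩ := exists_eq_pair hT hsub2 h2c hin
  obtain ⟨e, rfl⟩ := card_eq_one.1 h1c
  have hadj := hsub1 (show e ∈ (({e} : Finset (Sym2 V)) : Set (Sym2 V)) by simp)
  induction e with | _ x y
  rw [SimpleGraph.mem_edgeSet] at hadj
  have hy : y = M.mate x := by
    rcases M.adj_iff.1 hadj with h | h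
    · refine absurd ⟨M.tri x, M.isTriangle_tri x, ?_⟩ hout
      intro e he v hv
      rw [mem_singleton] at he
      subst he
      rcases Sym2.mem_iff.1 hv with rfl | rfl
      exacts [M.mem_tri _, h.2]
    · exact h
  subst hy
  have htri := (M.eq_tri hT (v := z) (by simp)).symm
  have hzu' := M.adj_of_mem (v := z) (w := u) (by simp [htri]) hzu
  have hzw' := M.adj_of_mem (v := z) (w := w) (by simp [htri]) hzw
  have hverts : ∀ a ∈ M.tri z, a ∈ (edgeSpan G {s(z, u), s(z, w)}).verts := by
    intro a ha
    rw [htri] at ha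
    simp only [mem_insert, mem_singleton] at ha
    rcases ha with rfl | rfl | rfl
    · exact ⟨u, hzu', by simp⟩
    · exact ⟨z, hzu'.symm, by simp⟩
    · exact ⟨z, hzw'.symm, by simp⟩
  rw [Set.disjoint_left] at hdisj
  refine hcon (M.connected_of_cross_edge h2 hc hzu hzw huw htri (x := x) ?_ ?_ ?_)
  · ext e
    have := congrArg (e ∈ ·) hEE
    simp at this ⊢
    tauto
  · exact fun h => hdisj (hverts _ h) ⟨M.mate x, hadj, by simp⟩
  · exact fun h => hdisj (hverts _ h) ⟨x, hadj.symm, by simp⟩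

-- Edges of triangles survive the deletion of `d` and `t`, so the components of `G - {d, t}` are
-- unions of triangles and `not_separated` applies to the one containing `z`.
include M in
theorem not_conditionE4 (h2 : IsTwoConnected G) (hE : (E : Set (Sym2 V)) ⊆ G.edgeSet)
    (hc : IsCentreMap (deleteEdgeSet G E) c) : ¬ ConditionE4 G E := by
  rintro ⟨E₂, E₁, ⟨hEE, h2c, h1c, -, -, -⟩, T, D, hT, hin, hD, hin', r, hrD, hr, d, hd, hrd, hdD,
    z, hzT, hz, t, ht, hzt, C₁, C₂, hC, hC₁, hC₂⟩
  have hsub2' : (E₂ : Set (Sym2 V)) ⊆ E := hEE ▸ Set.subset_union_left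
  have hsub1' : (E₁ : Set (Sym2 V)) ⊆ E := hEE ▸ Set.subset_union_right
  have hTz := M.eq_tri hT hzT
  have hDr := M.eq_tri hD hrD
  obtain ⟨u, w, hzu, hzw, huw, htri⟩ := M.exists_tri_eq z
  have hu : s(z, u) ∈ E := hz u (by rw [hTz, htri]; simp) hzu.symm
  have hw : s(z, w) ∈ E := hz w (by rw [hTz, htri]; simp) hzw.symm
  obtain ⟨t', rfl⟩ := Sym2.mem_iff_exists.1 hzt
  have ht' : t' = M.mate z := M.eq_mate_of_adj_deleteEdgeSet htri hu hw ht
  subst ht'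
  obtain ⟨d', rfl⟩ := Sym2.mem_iff_exists.1 hrd
  have hd' : d' = M.mate r := by
    rcases M.adj_iff.1 (SimpleGraph.mem_edgeSet _ |>.1 hd) with h | h
    · refine absurd ?_ hdD
      intro v hv
      rw [hDr]
      rcases Sym2.mem_iff.1 hv with rfl | rfl
      exacts [M.mem_tri _, h.2]
    · exact h
  subst hd'
  obtain ⟨e, rfl⟩ := card_eq_one.1 h1c
  have heE : e ∈ E := hsub1' (by simp)
  have hadj := hE heE
  have hine := hin' e (by simp)
  induction e with | _ p q
  rw [SimpleGraph.mem_edgeSet] at hadj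
  have hp : p ∈ M.tri r := hDr ▸ hine p (by simp)
  have hq : q ∈ M.tri r := hDr ▸ hine q (by simp)
  have hpv : p ∈ (edgeSpan G {s(p, q)}).verts := ⟨q, hadj, by simp⟩
  have hqv : q ∈ (edgeSpan G {s(p, q)}).verts := ⟨p, hadj.symm, by simp⟩
  have hrp : r ≠ p := by rintro rfl; exact hr hpv
  have hrq : r ≠ q := by rintro rfl; exact hr hqv
  have htri' := M.tri_eq_of_mem hp hq hrp hrq hadj.ne
  have hdel : ∀ a b, b ∈ M.tri a → a ≠ b →
      (G.deleteEdges {s(r, M.mate r), s(z, M.mate z)}).Adj a b := by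
    intro a b hb hab
    rw [SimpleGraph.deleteEdges_adj]
    refine ⟨M.adj_of_mem hb hab, ?_⟩
    simp only [Set.mem_insert_iff, Set.mem_singleton_iff, Sym2.eq_iff, not_or, not_and]
    refine ⟨⟨?_, ?_⟩, ⟨?_, ?_⟩⟩ <;> rintro rfl rfl
    · exact M.mate_notMem _ hb
    · exact M.mate_notMem _ (M.mem_comm hb)
    · exact M.mate_notMem _ hb
    · exact M.mate_notMem _ (M.mem_comm hb)
  classical
  have hmem : ∀ C : (G.deleteEdges {s(r, M.mate r), s(z, M.mate z)}).ConnectedComponent,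
      M.Closed C.supp.toFinset := by
    intro C a ha b hb
    rw [Set.mem_toFinset] at ha ⊢
    by_cases hab : a = b
    · exact hab ▸ ha
    · exact C.mem_supp_of_adj_mem_supp ha (hdel a b hb hab)
  have hpC : p ∈ C₁.supp := hC₁ hpv
  have hrC : r ∈ C₁.supp := by
    have := hmem C₁ p (by simpa using hpC) r (M.mem_comm hp)
    simpa using this
  have hzC : z ∈ C₂.supp := by
    obtain ⟨e, he⟩ := card_pos.1 (by omega : 0 < #E₂)
    have hadj := hE (hsub2' he)
    have hine := hin e he
    induction e with | _ a b
    have haC : a ∈ C₂.supp := hC₂ ⟨b, hadj, he⟩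
    have haT : a ∈ M.tri z := hTz ▸ hine a (by simp)
    have := hmem C₂ a (by simpa using haC) z (M.mem_comm haT)
    simpa using this
  refine M.not_separated h2 hc htri hu hw hrp htri' heE (hmem C₂) (by simpa using hzC) ?_ ?_
  · rw [Set.mem_toFinset]
    intro h
    rw [SimpleGraph.ConnectedComponent.mem_supp_iff] at h hrC
    exact hC (hrC.symm.trans h)
  · intro a ha hma
    rw [Set.mem_toFinset] at ha hma
    by_contra! h
    apply hma
    apply C₂.mem_supp_of_adj_mem_supp ha
    rw [SimpleGraph.deleteEdges_adj]
    exact ⟨M.adj_mate a, by simpa using h⟩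

end Conditions

end TriangleMatching

/-! ### Directed closed trails -/

theorem sum_darts_sub {H : SimpleGraph V} (f : V → ℤ) {u v : V} (p : H.Walk u v) :
    (p.darts.map fun d => f d.snd - f d.fst).sum = f v - f u := by
  induction p with
  | nil => simp
  | cons h p ih =>
    rw [SimpleGraph.Walk.darts_cons, List.map_cons, List.sum_cons, ih]
    simp

namespace TriangleMatching

variable {G : SimpleGraph V} (M : TriangleMatching G)

/-- `O` is the set of vertices at which a disjoint union of directed cycles, in the multigraph
obtained by contracting the triangles, leaves a triangle. -/
structure IsOutSet [DecidableEq V] (O : Finset V) : Prop where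
  mate_notMem : ∀ v ∈ O, M.mate v ∉ O
  balanced : ∀ S, M.Closed S → #{v ∈ O | v ∈ S} = #{v ∈ O | M.mate v ∈ S}

/-- A path from `mate z` to `z` closes up with the edge at `z` to a trail, so no edge is used in
both directions. The indicator of a union of triangles telescopes to zero along it, and steps inside
triangles contribute nothing; hence exits and entries balance. -/
theorem exists_outSet_of_reachable [Fintype V] [DecidableEq V] {F : Set (Sym2 V)} {z : V}
    (hz : s(z, M.mate z) ∉ F)
    (hr : (G.deleteEdges (insert s(z, M.mate z) F)).Reachable (M.mate z) z) :
    ∃ O, M.IsOutSet O ∧ z ∈ O ∧ ∀ v ∈ O, s(v, M.mate v) ∉ F := by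
  classical
  obtain ⟨p, hp⟩ := hr.exists_isPath
  have hle : G.deleteEdges (insert s(z, M.mate z) F) ≤ G := SimpleGraph.deleteEdges_le _
  set q : G.Walk z z := SimpleGraph.Walk.cons (M.adj_mate z) (p.mapLe hle) with hq
  have hpe : ∀ e ∈ (p.mapLe hle).edges, e ∉ insert s(z, M.mate z) F := by
    intro e he
    rw [SimpleGraph.Walk.edges_mapLe_eq_edges] at he
    have := p.edges_subset_edgeSet he
    rw [SimpleGraph.edgeSet_deleteEdges] at this
    exact this.2
  have hqt : q.IsTrail := by
    rw [hq, SimpleGraph.Walk.isTrail_cons]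
    refine ⟨?_, fun h => hpe _ h (Set.mem_insert _ _)⟩
    exact (SimpleGraph.Walk.isTrail_mapLe hle).2 hp.isTrail
  have hqn : (q.darts.map SimpleGraph.Dart.edge).Nodup := hqt.edges_nodup
  have hnd : q.darts.Nodup := hqn.of_map
  let D : V → G.Dart := fun v => ⟨(v, M.mate v), M.adj_mate v⟩
  have hDinj : Function.Injective D := fun v w h =>
    congrArg (fun d : G.Dart => d.fst) h
  let O : Finset V := {v | D v ∈ q.darts}
  have hO : ∀ v, v ∈ O ↔ D v ∈ q.darts := by simp [O]
  refine ⟨O, ⟨?_, ?_⟩, ?_, ?_⟩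
  · intro v hv hmv
    rw [hO] at hv hmv
    have h1 : D v = D (M.mate v) := by
      apply List.inj_on_of_nodup_map hqn hv hmv
      simp only [D, SimpleGraph.Dart.edge, M.mate_mate]
      exact Sym2.eq_swap
    exact M.mate_ne v (hDinj h1).symm
  · intro S hS
    let f : V → ℤ := fun v => if v ∈ S then 1 else 0
    have h1 := sum_darts_sub f q
    rw [sub_self, ← List.sum_toFinset _ hnd] at h1
    have h2 : ∑ d ∈ q.darts.toFinset, (f d.snd - f d.fst) =
        ∑ d ∈ O.map ⟨D, hDinj⟩, (f d.snd - f d.fst) := by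
      symm
      apply sum_subset
      · intro d hd
        rw [mem_map] at hd
        obtain ⟨v, hv, rfl⟩ := hd
        rw [List.mem_toFinset]
        exact (hO v).1 hv
      · intro d hd hd'
        have hadj := d.adj
        rcases M.adj_iff.1 hadj with h | h
        · have : d.fst ∈ S ↔ d.snd ∈ S := ⟨fun h' => hS _ h' _ h.2,
            fun h' => hS _ h' _ (M.mem_comm h.2)⟩
          simp [f, this]
        · exfalso
          apply hd'
          have hdD : D d.fst = d := by
            apply SimpleGraph.Dart.ext
            exact Prod.ext rfl h.symm
          rw [mem_map]
          refine ⟨d.fst, (hO _).2 ?_, hdD⟩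
          rw [hdD]
          exact List.mem_toFinset.1 hd
    rw [h2, sum_map, sum_sub_distrib] at h1
    simp only [f, Function.Embedding.coeFn_mk, D, sum_boole] at h1
    have h3 := sub_eq_zero.1 h1
    exact_mod_cast h3.symm
  · rw [hO, hq, SimpleGraph.Walk.darts_cons]
    exact List.mem_cons_self
  · intro v hv
    rw [hO] at hv
    have he : (D v).edge ∈ q.edges := List.mem_map_of_mem hv
    rw [hq, SimpleGraph.Walk.edges_cons, List.mem_cons] at he
    rcases he with he | he
    · change s(v, M.mate v) = _ at he
      rwa [he]
    · exact fun h => hpe _ he (Set.mem_insert_of_mem _ h)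

theorem adj_deleteEdges_of_mem {F : Set (Sym2 V)} (hF : ∀ a b, b ∈ M.tri a → s(a, b) ∉ F)
    {a b : V} (hb : b ∈ M.tri a) (hab : a ≠ b) : (G.deleteEdges F).Adj a b := by
  rw [SimpleGraph.deleteEdges_adj]
  exact ⟨M.adj_of_mem hb hab, hF a b hb⟩

/-- Either a directed closed trail through the edge at `z` avoids the set `F` of edges joining
different triangles, or `F` and this edge separate the graph. -/
theorem exists_outSet_or_separation [Fintype V] [DecidableEq V] {F : Set (Sym2 V)} {z : V}
    (hF : ∀ a b, b ∈ M.tri a → s(a, b) ∉ F) (hz : s(z, M.mate z) ∉ F) :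
    (∃ O, M.IsOutSet O ∧ z ∈ O ∧ ∀ v ∈ O, s(v, M.mate v) ∉ F) ∨
    ∃ S, M.Closed S ∧ z ∈ S ∧ M.mate z ∉ S ∧
      ∀ a ∈ S, M.mate a ∉ S → a = z ∨ s(a, M.mate a) ∈ F := by
  classical
  by_cases hr : (G.deleteEdges (insert s(z, M.mate z) F)).Reachable (M.mate z) z
  · exact Or.inl (M.exists_outSet_of_reachable hz hr)
  right
  have hr' : ∃ S : Set V, (∀ a ∈ S, ∀ b, (G.deleteEdges (insert s(z, M.mate z) F)).Adj a b → b ∈ S)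
      ∧ z ∈ S ∧ M.mate z ∉ S := by
    by_contra! h
    exact hr (reachable_of_forall_closed h).symm
  obtain ⟨S, hS, hzS, hmS⟩ := hr'
  have hF' : ∀ a b, b ∈ M.tri a → s(a, b) ∉ insert s(z, M.mate z) F := by
    intro a b hb
    rw [Set.mem_insert_iff, not_or, Sym2.eq_iff, not_or, not_and, not_and]
    refine ⟨⟨?_, ?_⟩, hF a b hb⟩ <;> rintro rfl rfl
    · exact M.mate_notMem _ hb
    · exact M.mate_notMem _ (M.mem_comm hb)
  refine ⟨S.toFinset, ?_, by simpa using hzS, by simpa using hmS, ?_⟩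
  · intro a ha b hb
    rw [Set.mem_toFinset] at ha ⊢
    by_cases hab : a = b
    · exact hab ▸ ha
    · exact hS a ha b (M.adj_deleteEdges_of_mem hF' hb hab)
  · intro a ha hma
    rw [Set.mem_toFinset] at ha hma
    by_contra! h
    apply hma
    apply hS a ha
    rw [SimpleGraph.deleteEdges_adj, Set.mem_insert_iff, not_or, Sym2.eq_iff, not_or, not_and,
      not_and]
    refine ⟨M.adj_mate a, ⟨fun h' => absurd h' h.1, ?_⟩, h.2⟩
    rintro rfl
    exact absurd ha hmS

/-! ### From directed cycles to Λ-factors. -/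

section OutSet

variable [DecidableEq V] {M} {O : Finset V}

theorem IsOutSet.card_eq (hO : M.IsOutSet O) (x : V) :
    #{v ∈ M.tri x | v ∈ O} = #{v ∈ M.tri x | M.mate v ∈ O} := by
  have h1 := hO.balanced _ (M.closed_tri x)
  have h2 : ({v ∈ O | v ∈ M.tri x} : Finset V) = {v ∈ M.tri x | v ∈ O} := by
    ext; simp [and_comm]
  have h3 : ({v ∈ O | M.mate v ∈ M.tri x} : Finset V).image M.mate =
      {v ∈ M.tri x | M.mate v ∈ O} := by
    ext v
    simp only [mem_image, mem_filter]
    constructor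
    · rintro ⟨w, hw, rfl⟩
      exact ⟨hw.2, by rw [M.mate_mate]; exact hw.1⟩
    · rintro ⟨h, h'⟩
      exact ⟨M.mate v, ⟨h', by rwa [M.mate_mate]⟩, M.mate_mate v⟩
  rw [← h2, ← h3, h1, card_image_of_injective]
  exact fun _ _ => M.mate_inj

/-- Exits and entries of a triangle are disjoint sets of equal size among three vertices. -/
theorem IsOutSet.card_le_one (hO : M.IsOutSet O) (x : V) : #{v ∈ M.tri x | v ∈ O} ≤ 1 := by
  have h1 := hO.card_eq x
  have hdisj : Disjoint ({v ∈ M.tri x | v ∈ O} : Finset V) {v ∈ M.tri x | M.mate v ∈ O} := by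
    rw [disjoint_left]
    intro v hv hv'
    rw [mem_filter] at hv hv'
    exact hO.mate_notMem v hv.2 hv'.2
  have h2 := card_union_of_disjoint hdisj
  have h3 : #(({v ∈ M.tri x | v ∈ O} : Finset V) ∪ {v ∈ M.tri x | M.mate v ∈ O}) ≤ 3 := by
    rw [← M.card_tri x]
    exact card_le_card (union_subset (filter_subset _ _) (filter_subset _ _))
  omega

theorem IsOutSet.exists_mem (hO : M.IsOutSet O) {a : V} (ha : M.mate a ∈ O) :
    ∃ b ∈ M.tri a, b ∈ O ∧ ∀ x ∈ M.tri a, x ∈ O → x = b := by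
  have h1 : 0 < #{v ∈ M.tri a | v ∈ O} := by
    rw [hO.card_eq]
    exact card_pos.2 ⟨a, by simp [M.mem_tri, ha]⟩
  obtain ⟨b, hb⟩ := card_pos.1 h1
  have h2 := Finset.card_le_one.1 (hO.card_le_one a)
  refine ⟨b, (mem_filter.1 hb).1, (mem_filter.1 hb).2, fun x hx hxO => ?_⟩
  exact h2 x (mem_filter.2 ⟨hx, hxO⟩) b hb

theorem IsOutSet.exists_mate_mem (hO : M.IsOutSet O) {x b : V} (hb : b ∈ M.tri x) (hbO : b ∈ O) :
    ∃ a ∈ M.tri x, M.mate a ∈ O := by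
  have h1 : 0 < #{v ∈ M.tri x | M.mate v ∈ O} := by
    rw [← hO.card_eq]
    exact card_pos.2 ⟨b, by simp [hb, hbO]⟩
  obtain ⟨a, ha⟩ := card_pos.1 h1
  exact ⟨a, (mem_filter.1 ha).1, (mem_filter.1 ha).2⟩

theorem IsOutSet.eq_of_mate_mem (hO : M.IsOutSet O) {a b : V} (hb : b ∈ M.tri a)
    (haO : M.mate a ∈ O) (hbO : M.mate b ∈ O) : b = a := by
  have h1 := hO.card_le_one a
  rw [hO.card_eq] at h1
  exact Finset.card_le_one.1 h1 b (mem_filter.2 ⟨hb, hbO⟩) a (mem_filter.2 ⟨M.mem_tri a, haO⟩)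

/-- The `Λ`-factor carried by a disjoint union of directed cycles of triangles. -/
theorem IsOutSet.exists_centreMap [Fintype V] (hO : M.IsOutSet O) {G' : SimpleGraph V}
    (hout : ∀ v ∈ O, G'.Adj v (M.mate v))
    (hfree : ∀ x, (∀ v ∈ M.tri x, v ∉ O) →
      ∃ y ∈ M.tri x, ∀ y' ∈ M.tri x, y' ≠ y → G'.Adj y y')
    (hin : ∀ a, M.mate a ∈ O → ∀ b ∈ M.tri a, b ≠ a → b ∉ O → G'.Adj a b) :
    ∃ c, IsCentreMap G' c := by
  -- The centre is chosen per triangle rather than per vertex, so that `t` is constant on triangles.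
  have hex : ∀ T : Finset V, T ∈ Set.range M.tri → ∃ y ∈ T, M.mate y ∈ O ∨
      ((∀ v ∈ T, v ∉ O) ∧ ∀ y' ∈ T, y' ≠ y → G'.Adj y y') := by
    rintro _ ⟨x, rfl⟩
    by_cases h : ∀ v ∈ M.tri x, v ∉ O
    · obtain ⟨y, hy, hy'⟩ := hfree x h
      exact ⟨y, hy, Or.inr ⟨h, hy'⟩⟩
    · push Not at h
      obtain ⟨b, hb, hbO⟩ := h
      obtain ⟨a, ha, haO⟩ := hO.exists_mate_mem hb hbO
      exact ⟨a, ha, Or.inl haO⟩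
  choose g hgmem hg using hex
  let t : V → V := fun x => g (M.tri x) ⟨x, rfl⟩
  have htmem : ∀ x, t x ∈ M.tri x := fun x => hgmem _ _
  have ht : ∀ x, M.mate (t x) ∈ O ∨
      ((∀ v ∈ M.tri x, v ∉ O) ∧ ∀ y' ∈ M.tri x, y' ≠ t x → G'.Adj (t x) y') := fun x => hg _ _
  have htcongr : ∀ {x y}, y ∈ M.tri x → t y = t x := by
    intro x y hy
    have : ∀ (T T' : Finset V) (h : T = T') h1 h2, g T h1 = g T' h2 := by
      rintro _ _ rfl _ _
      rfl
    exact this _ _ (M.tri_eq hy) _ _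
  have htO : ∀ x, t x ∉ O := by
    intro x hx
    rcases ht x with h | h
    · exact hO.mate_notMem _ hx h
    · exact h.1 _ (htmem x) hx
  have htin : ∀ a, M.mate a ∈ O → t a = a := by
    intro a ha
    obtain ⟨b, hb, hbO, -⟩ := hO.exists_mem ha
    rcases ht a with h | h
    · exact hO.eq_of_mate_mem (htmem a) ha h
    · exact absurd hbO (h.1 b hb)
  let c : V → V := fun v => if v ∈ O then M.mate v else t v
  have hcO : ∀ {v}, v ∈ O → c v = M.mate v := fun h => if_pos h
  have hcn : ∀ {v}, v ∉ O → c v = t v := fun h => if_neg h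
  have hidem : ∀ v, c v ∉ O ∧ c (c v) = c v := by
    intro v
    by_cases hv : v ∈ O
    · rw [hcO hv, hcn (hO.mate_notMem v hv)]
      exact ⟨hO.mate_notMem v hv, htin _ (by rwa [M.mate_mate])⟩
    · rw [hcn hv, hcn (htO v)]
      exact ⟨htO v, htcongr (htmem v)⟩
  refine ⟨c, fun v => (hidem v).2, ?_, ?_⟩
  · intro v hv
    by_cases hvO : v ∈ O
    · rw [hcO hvO]
      exact hout v hvO
    · rw [hcn hvO] at hv ⊢
      rcases ht v with h | h
      · exact (hin _ h v (M.mem_comm (htmem v)) hv.symm hvO).symm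
      · exact (h.2 v (M.mem_tri v) hv.symm).symm
  · intro v
    obtain ⟨hyO, hy⟩ := hidem v
    generalize c v = y at hyO hy
    have hty : t y = y := by rwa [hcn hyO] at hy
    have hiff : ∀ x, c x = y ↔ (x ∈ O ∧ x = M.mate y) ∨ (x ∉ O ∧ x ∈ M.tri y) := by
      intro x
      by_cases hx : x ∈ O
      · rw [hcO hx]
        simp only [hx, true_and, not_true_eq_false, false_and, or_false]
        constructor <;> rintro rfl <;> rw [M.mate_mate]
      · rw [hcn hx]
        simp only [hx, not_false_eq_true, true_and, false_and, false_or]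
        constructor
        · rintro rfl
          exact M.mem_comm (htmem x)
        · intro h
          rw [htcongr h, hty]
    by_cases hmy : M.mate y ∈ O
    · obtain ⟨b, hb, hbO, hbu⟩ := hO.exists_mem hmy
      -- In a triangle entered at `y`, the exit `b` is traded for the incoming leaf `mate y`.
      have hset : ({x | c x = y} : Finset V) = insert (M.mate y) ((M.tri y).erase b) := by
        ext x
        simp only [mem_filter, mem_univ, true_and, mem_insert, mem_erase, hiff]
        constructor
        · rintro (h | h)
          · exact Or.inl h.2
          · exact Or.inr ⟨fun h' => h.1 (h' ▸ hbO), h.2⟩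
        · rintro (rfl | h)
          · exact Or.inl ⟨hmy, rfl⟩
          · exact Or.inr ⟨fun h' => h.1 (hbu x h.2 h'), h.2⟩
      rw [hset, card_insert_of_notMem, card_erase_of_mem hb, M.card_tri]
      exact fun h => M.mate_notMem y (mem_of_mem_erase h)
    · have hno : ∀ x ∈ M.tri y, x ∉ O := by
        rcases ht y with h | h
        · exact absurd (hty ▸ h) hmy
        · exact h.1
      have hset : ({x | c x = y} : Finset V) = M.tri y := by
        ext x
        simp only [mem_filter, mem_univ, true_and, hiff]
        constructor
        · rintro (h | h)
          · exact absurd (h.2 ▸ h.1) hmy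
          · exact h.2
        · exact fun h => Or.inr ⟨hno x h, h⟩
      rw [hset, M.card_tri]

/-- The case in which two of the three deleted edges lie in the triangle of `z`. -/
theorem IsOutSet.exists_centreMap_deleteEdgeSet [Fintype V] (hO : M.IsOutSet O)
    {E : Finset (Sym2 V)} {z u w : V} {e : Sym2 V} (htri : M.tri z = {z, u, w})
    (hE : E = {s(z, u), s(z, w), e}) (hz : z ∈ O) (he : ∀ v ∈ O, s(v, M.mate v) ≠ e)
    (hD : ∀ p q, p ≠ q → q ∈ M.tri p → s(p, q) = e →
      p ∉ M.tri z ∧ ∀ r ∈ M.tri p, r ≠ p → r ≠ q → r ∉ O) :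
    ∃ c, IsCentreMap (deleteEdgeSet G E) c := by
  have huT : u ∈ M.tri z := by simp [htri]
  have hwT : w ∈ M.tri z := by simp [htri]
  have hadj : ∀ {a b}, G.Adj a b → s(a, b) ≠ s(z, u) → s(a, b) ≠ s(z, w) → s(a, b) ≠ e →
      (deleteEdgeSet G E).Adj a b := by
    intro a b hab h1 h2 h3
    rw [deleteEdgeSet_adj]
    refine ⟨hab, ?_⟩
    simp [hE, h1, h2, h3]
  have hne : ∀ {a b x}, x ∈ M.tri z → s(a, b) = s(z, x) → (a = z ∨ b = z) ∧ b ∈ M.tri a := by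
    intro a b x hx h
    rcases Sym2.eq_iff.1 h with ⟨rfl, rfl⟩ | ⟨rfl, rfl⟩
    · exact ⟨Or.inl rfl, hx⟩
    · exact ⟨Or.inr rfl, M.mem_comm hx⟩
  refine hO.exists_centreMap ?_ ?_ ?_
  · intro v hv
    exact hadj (M.adj_mate v) (fun h => M.mate_notMem v (hne huT h).2)
      (fun h => M.mate_notMem v (hne hwT h).2) (he v hv)
  · intro x hx
    have hzx : z ∉ M.tri x := fun h => hx z h hz
    have hadj' : ∀ a ∈ M.tri x, ∀ b ∈ M.tri x, a ≠ b → s(a, b) ≠ e →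
        (deleteEdgeSet G E).Adj a b := by
      intro a ha b hb hab h
      have hz' : ∀ {x'}, x' ∈ M.tri z → s(a, b) ≠ s(z, x') := by
        intro x' hx' h
        rcases (hne hx' h).1 with rfl | rfl
        exacts [hzx ha, hzx hb]
      exact hadj (M.adj_of_mem (by rwa [M.tri_eq ha]) hab) (hz' huT) (hz' hwT) h
    by_cases hpq : ∃ p ∈ M.tri x, ∃ q ∈ M.tri x, p ≠ q ∧ s(p, q) = e
    · obtain ⟨p, hp, q, hq, hpq, rfl⟩ := hpq
      have hcard : 0 < #(((M.tri x).erase p).erase q) := by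
        rw [card_erase_of_mem (mem_erase.2 ⟨hpq.symm, hq⟩), card_erase_of_mem hp, M.card_tri]
        simp
      obtain ⟨r, hr⟩ := card_pos.1 hcard
      simp only [mem_erase] at hr
      -- The vertex opposite the deleted edge still sees both others.
      refine ⟨r, hr.2.2, fun y' hy' hne' => hadj' r hr.2.2 y' hy' hne'.symm ?_⟩
      intro h
      rcases Sym2.eq_iff.1 h with h | h
      exacts [hr.2.1 h.1, hr.1 h.1]
    · push Not at hpq
      exact ⟨x, M.mem_tri x, fun y' hy' hne' =>
        hadj' x (M.mem_tri x) y' hy' hne'.symm (hpq x (M.mem_tri x) y' hy' hne'.symm)⟩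
  · intro a ha b hb hba hbO
    have haO : a ∉ O := fun h => hO.mate_notMem a h ha
    have hz' : ∀ {x'}, x' ∈ M.tri z → s(a, b) ≠ s(z, x') := by
      intro x' hx' h
      rcases (hne hx' h).1 with rfl | rfl
      exacts [haO hz, hbO hz]
    -- If `ab` were the deleted edge `e`, the exit would be the third vertex of the triangle, which
    -- `hD` forbids.
    refine hadj (M.adj_of_mem hb hba.symm) (hz' huT) (hz' hwT) fun h => ?_
    obtain ⟨r, hr, hrO, -⟩ := hO.exists_mem ha
    exact (hD a b hba.symm hb h).2 r hr (fun h => haO (h ▸ hrO)) (fun h => hbO (h ▸ hrO)) hrO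

end OutSet

end TriangleMatching

/-! ### Recognising the exceptional edge sets -/

theorem spansClaw_of_eq [DecidableEq V] {G : SimpleGraph V} {E : Finset (Sym2 V)} {z a b c : V}
    (ha : G.Adj z a) (hb : G.Adj z b) (hc : G.Adj z c) (hab : a ≠ b) (hac : a ≠ c) (hbc : b ≠ c)
    (hE : E = {s(z, a), s(z, b), s(z, c)}) : SpansClaw G E := by
  have hadj : ∀ v w, (edgeSpan G E).Adj v w ↔ (v = z ∧ (w = a ∨ w = b ∨ w = c)) ∨
      (w = z ∧ (v = a ∨ v = b ∨ v = c)) := by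
    intro v w
    change G.Adj v w ∧ s(v, w) ∈ E ↔ _
    rw [hE]
    simp only [mem_insert, mem_singleton, Sym2.eq_iff]
    constructor
    · tauto
    · rintro (⟨rfl, rfl | rfl | rfl⟩ | ⟨rfl, rfl | rfl | rfl⟩) <;>
        simp [ha, hb, hc, ha.symm, hb.symm, hc.symm]
  have hz : z ∈ (edgeSpan G E).verts := (edgeSpan G E).edge_vert ((hadj z a).2 (by simp))
  have ha' : a ∈ (edgeSpan G E).verts := (edgeSpan G E).edge_vert ((hadj a z).2 (by simp))
  have hb' : b ∈ (edgeSpan G E).verts := (edgeSpan G E).edge_vert ((hadj b z).2 (by simp))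
  have hc' : c ∈ (edgeSpan G E).verts := (edgeSpan G E).edge_vert ((hadj c z).2 (by simp))
  let f : Fin 1 ⊕ Fin 3 → (edgeSpan G E).verts :=
    Sum.elim (fun _ => ⟨z, hz⟩) ![⟨a, ha'⟩, ⟨b, hb'⟩, ⟨c, hc'⟩]
  have hbij : Function.Bijective f := by
    constructor
    · rintro (i | i) (j | j) hij
      · rw [Subsingleton.elim i j]
      · fin_cases j <;> simp [f, ha.ne, hb.ne, hc.ne] at hij
      · fin_cases i <;> simp [f, ha.ne', hb.ne', hc.ne'] at hij
      · fin_cases i <;> fin_cases j <;>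
          simp [f, hab, hac, hbc, hab.symm, hac.symm, hbc.symm] at hij ⊢
    · rintro ⟨y, y', hy⟩
      rcases (hadj y y').1 hy with ⟨rfl, -⟩ | ⟨-, rfl | rfl | rfl⟩
      · exact ⟨Sum.inl 0, rfl⟩
      · exact ⟨Sum.inr 0, rfl⟩
      · exact ⟨Sum.inr 1, rfl⟩
      · exact ⟨Sum.inr 2, rfl⟩
  refine ⟨RelIso.symm ⟨Equiv.ofBijective f hbij, ?_⟩⟩
  intro i j
  change (edgeSpan G E).Adj (f i).1 (f j).1 ↔ _
  rw [hadj]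
  rcases i with i | i <;> rcases j with j | j
  · simp [f, ha.ne, hb.ne, hc.ne]
  · fin_cases j <;> simp [f]
  · fin_cases i <;> simp [f]
  · fin_cases i <;> fin_cases j <;> simp [f, ha.ne', hb.ne', hc.ne']

theorem spansTriangle_of_eq [DecidableEq V] {G : SimpleGraph V} {E : Finset (Sym2 V)} {a b c : V}
    (hab : G.Adj a b) (hac : G.Adj a c) (hbc : G.Adj b c)
    (hE : E = {s(a, b), s(a, c), s(b, c)}) : SpansTriangle G E := by
  have hadj : ∀ v w, (edgeSpan G E).Adj v w ↔
      v ≠ w ∧ (v = a ∨ v = b ∨ v = c) ∧ (w = a ∨ w = b ∨ w = c) := by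
    intro v w
    change G.Adj v w ∧ s(v, w) ∈ E ↔ _
    rw [hE]
    simp only [mem_insert, mem_singleton, Sym2.eq_iff]
    constructor
    · rintro ⟨h, h'⟩
      exact ⟨h.ne, by tauto, by tauto⟩
    · rintro ⟨h, rfl | rfl | rfl, rfl | rfl | rfl⟩ <;>
        simp_all [hab.symm, hac.symm, hbc.symm]
  have ha' : a ∈ (edgeSpan G E).verts :=
    (edgeSpan G E).edge_vert ((hadj a b).2 ⟨hab.ne, by simp⟩)
  have hb' : b ∈ (edgeSpan G E).verts :=
    (edgeSpan G E).edge_vert ((hadj b a).2 ⟨hab.ne', by simp⟩)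
  have hc' : c ∈ (edgeSpan G E).verts :=
    (edgeSpan G E).edge_vert ((hadj c a).2 ⟨hac.ne', by simp⟩)
  let f : Fin 3 → (edgeSpan G E).verts := ![⟨a, ha'⟩, ⟨b, hb'⟩, ⟨c, hc'⟩]
  have hbij : Function.Bijective f := by
    constructor
    · intro i j hij
      fin_cases i <;> fin_cases j <;>
        simp [f, hab.ne, hac.ne, hbc.ne, hab.ne', hac.ne', hbc.ne'] at hij ⊢
    · rintro ⟨y, y', hy⟩
      rcases ((hadj y y').1 hy).2.1 with rfl | rfl | rfl
      exacts [⟨0, rfl⟩, ⟨1, rfl⟩, ⟨2, rfl⟩]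
  refine ⟨RelIso.symm ⟨Equiv.ofBijective f hbij, ?_⟩⟩
  intro i j
  change (edgeSpan G E).Adj (f i).1 (f j).1 ↔ _
  rw [hadj]
  fin_cases i <;> fin_cases j <;>
    simp [f, hab.ne, hac.ne, hbc.ne, hab.ne', hac.ne', hbc.ne']

theorem edgeSpan_singleton {G : SimpleGraph V} {a b : V} (hab : G.Adj a b) :
    edgeSpan G {s(a, b)} = G.subgraphOfAdj hab := by
  ext v w
  · simp only [edgeSpan, Set.mem_ofPred_eq, mem_singleton, SimpleGraph.subgraphOfAdj_verts,
      Set.mem_insert_iff, Set.mem_singleton_iff, Sym2.eq_iff]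
    constructor
    · rintro ⟨w, -, h⟩
      tauto
    · rintro (rfl | rfl)
      exacts [⟨b, hab, by simp⟩, ⟨a, hab.symm, by simp⟩]
  · simp only [edgeSpan, mem_singleton, SimpleGraph.subgraphOfAdj_adj]
    constructor
    · exact fun h => h.2.symm
    · intro h
      refine ⟨?_, h.symm⟩
      rw [← SimpleGraph.mem_edgeSet, ← h]
      exact hab

theorem edgeSpan_pair [DecidableEq V] {G : SimpleGraph V} {z u w : V} (hu : G.Adj z u)
    (hw : G.Adj z w) :
    edgeSpan G {s(z, u), s(z, w)} = G.subgraphOfAdj hu ⊔ G.subgraphOfAdj hw := by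
  rw [← edgeSpan_singleton, ← edgeSpan_singleton]
  ext v x
  · simp only [edgeSpan, Set.mem_ofPred_eq, mem_singleton, SimpleGraph.Subgraph.verts_sup,
      Set.mem_union, mem_insert]
    simp only [and_or_left, exists_or]
  · simp only [edgeSpan, mem_singleton, SimpleGraph.Subgraph.sup_adj, mem_insert]
    tauto

theorem mem_verts_edgeSpan_singleton {G : SimpleGraph V} {a b v : V} (hab : G.Adj a b) :
    v ∈ (edgeSpan G {s(a, b)}).verts ↔ v = a ∨ v = b := by
  rw [edgeSpan_singleton hab]
  simp

theorem mem_verts_edgeSpan_pair [DecidableEq V] {G : SimpleGraph V} {z u w v : V} (hu : G.Adj z u)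
    (hw : G.Adj z w) : v ∈ (edgeSpan G {s(z, u), s(z, w)}).verts ↔ v = z ∨ v = u ∨ v = w := by
  rw [edgeSpan_pair hu hw]
  simp
  tauto

theorem hasTwoComponents_of_eq [DecidableEq V] {G : SimpleGraph V} {E : Finset (Sym2 V)}
    {z u w a b : V} (hu : G.Adj z u) (hw : G.Adj z w) (huw : u ≠ w) (hab : G.Adj a b)
    (ha : a ≠ z ∧ a ≠ u ∧ a ≠ w) (hb : b ≠ z ∧ b ≠ u ∧ b ≠ w)
    (hE : E = {s(z, u), s(z, w), s(a, b)}) :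
    HasTwoComponents G E {s(z, u), s(z, w)} {s(a, b)} := by
  refine ⟨?_, ?_, card_singleton _, ?_, ?_, ?_⟩
  · rw [hE]
    ext e
    simp
    tauto
  · apply card_pair
    intro h
    rcases Sym2.eq_iff.1 h with h | h
    · exact huw h.2
    · exact hu.ne h.2.symm
  · rw [edgeSpan_pair hu hw]
    refine SimpleGraph.Subgraph.connected_sup
      (SimpleGraph.Subgraph.subgraphOfAdj_connected hu).preconnected
      (SimpleGraph.Subgraph.subgraphOfAdj_connected hw).preconnected ⟨z, ?_⟩
    simp
  · rw [edgeSpan_singleton hab]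
    exact SimpleGraph.Subgraph.subgraphOfAdj_connected hab
  · rw [Set.disjoint_left]
    intro v hv hv'
    rw [mem_verts_edgeSpan_pair hu hw] at hv
    rw [mem_verts_edgeSpan_singleton hab] at hv'
    rcases hv' with rfl | rfl <;> tauto

/-! ### Construction of a Λ-factor outside (e1)–(e4). -/

namespace TriangleMatching

variable {G : SimpleGraph V} (M : TriangleMatching G)

theorem notMem_singleton_mate (x : V) : ∀ a b, b ∈ M.tri a → s(a, b) ∉ ({s(x, M.mate x)} : Set _) := by
  intro a b hb
  rw [Set.mem_singleton_iff, Sym2.eq_iff, not_or, not_and, not_and]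
  constructor <;> rintro rfl rfl
  · exact M.mate_notMem _ hb
  · exact M.mate_notMem _ (M.mem_comm hb)

section Existence

variable [Fintype V] [DecidableEq V] {E : Finset (Sym2 V)} {z u w : V}

theorem exists_outSet (h2 : IsTwoConnected G) (z : V) : ∃ O, M.IsOutSet O ∧ z ∈ O := by
  rcases M.exists_outSet_or_separation (F := ∅) (z := z) (by simp) (by simp) with
    ⟨O, hO, hz, -⟩ | ⟨S, hS, hz, hmz, hb⟩
  · exact ⟨O, hO, hz⟩
  · obtain ⟨a, ha, b, hb', hab, hma, hmb⟩ := M.exists_two_boundary h2 hS hz hmz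
    have h1 := hb a ha hma
    have h3 := hb b hb' hmb
    simp only [Set.mem_empty_iff_false, or_false] at h1 h3
    exact absurd (h1.trans h3.symm) hab

/-- A cycle leaving at `z` can avoid the edge at `u`: a cut preventing this would leave, after
removal of the triangle of `z`, a union of triangles attached only through `w`. -/
theorem exists_centreMap_of_adjacent (h2 : IsTwoConnected G) (hzu : z ≠ u) (hzw : z ≠ w)
    (huw : u ≠ w) (htri : M.tri z = {z, u, w}) (hE : E = {s(z, u), s(z, w), s(u, M.mate u)}) :
    ∃ c, IsCentreMap (deleteEdgeSet G E) c := by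
  have huT : u ∈ M.tri z := by simp [htri]
  have hwT : w ∈ M.tri z := by simp [htri]
  have hzF : s(z, M.mate z) ∉ ({s(u, M.mate u)} : Set (Sym2 V)) := by
    rw [Set.mem_singleton_iff, Sym2.eq_iff, not_or]
    exact ⟨fun h => hzu h.1, fun h => M.mate_ne_of_mem huT h.2⟩
  rcases M.exists_outSet_or_separation (M.notMem_singleton_mate u) hzF with
    ⟨O, hO, hz, hF⟩ | ⟨S, hS, hz, hmz, hb⟩
  · refine hO.exists_centreMap_deleteEdgeSet htri hE hz (fun v hv => by simpa using hF v hv) ?_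
    intro p q _ hq he
    exact absurd he (M.notMem_singleton_mate u p q hq)
  · exfalso
    have huS := hS z hz u huT
    have hwS := hS z hz w hwT
    have hb' : ∀ a ∈ S, M.mate a ∉ S → a = z ∨ a = u := by
      intro a ha hma
      rcases hb a ha hma with h | h
      · exact Or.inl h
      · rw [Set.mem_singleton_iff, Sym2.eq_iff] at h
        rcases h with h | h
        · exact Or.inr h.1
        · exact absurd (h.2 ▸ huS) hma
    have hmu : M.mate u ∉ S := by
      obtain ⟨a, ha, b, hbS, hab, hma, hmb⟩ := M.exists_two_boundary h2 hS hz hmz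
      rcases hb' a ha hma with rfl | rfl
      · rcases hb' b hbS hmb with rfl | rfl
        exacts [absurd rfl hab, hmb]
      · exact hma
    have hmw : M.mate w ∈ S := by
      by_contra h
      rcases hb' w hwS h with h | h
      exacts [hzw h.symm, huw h.symm]
    have hcl : M.Closed (S \ M.tri z) := by
      intro a ha b hb
      rw [mem_sdiff] at ha ⊢
      refine ⟨hS a ha.1 b hb, fun h => ha.2 ?_⟩
      rw [← M.tri_eq h]
      exact M.mem_comm hb
    have hmwT : M.mate w ∉ M.tri z := by
      rw [← M.tri_eq hwT]
      exact M.mate_notMem w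
    obtain ⟨a, ha, b, hb, hab, hma, hmb⟩ := M.exists_two_boundary h2 hcl
      (mem_sdiff.2 ⟨hmw, hmwT⟩) (y := z) (by simp [M.mem_tri])
    have key : ∀ a ∈ S \ M.tri z, M.mate a ∉ S \ M.tri z → M.mate a = w := by
      intro a ha hma
      rw [mem_sdiff] at ha hma
      by_cases h : M.mate a ∈ S
      · have h' : M.mate a ∈ M.tri z := by
          by_contra h'
          exact hma ⟨h, h'⟩
        rw [htri] at h'
        simp only [mem_insert, mem_singleton] at h'
        rcases h' with h' | h' | h'
        · rw [← h', M.mate_mate] at hmz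
          exact absurd ha.1 hmz
        · rw [← h', M.mate_mate] at hmu
          exact absurd ha.1 hmu
        · exact h'
      · rcases hb' a ha.1 h with rfl | rfl
        exacts [absurd (M.mem_tri _) ha.2, absurd huT ha.2]
    exact hab (M.mate_inj ((key a ha hma).trans (key b hb hmb).symm))

theorem exists_centreMap_of_not_conditionE3 (hzu : z ≠ u) (hzw : z ≠ w) (huw : u ≠ w)
    (htri : M.tri z = {z, u, w}) {x : V} (hx : x ∉ M.tri z) (hmx : M.mate x ∉ M.tri z)
    (hE : E = {s(z, u), s(z, w), s(x, M.mate x)}) (h3 : ¬ ConditionE3 G E) :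
    ∃ c, IsCentreMap (deleteEdgeSet G E) c := by
  have huT : u ∈ M.tri z := by simp [htri]
  have hwT : w ∈ M.tri z := by simp [htri]
  have hzF : s(z, M.mate z) ∉ ({s(x, M.mate x)} : Set (Sym2 V)) := by
    rw [Set.mem_singleton_iff, Sym2.eq_iff, not_or]
    exact ⟨fun h => hx (h.1 ▸ M.mem_tri z), fun h => hmx (h.1 ▸ M.mem_tri z)⟩
  rcases M.exists_outSet_or_separation (M.notMem_singleton_mate x) hzF with
    ⟨O, hO, hz, hF⟩ | ⟨S, hS, hz, hmz, hb⟩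
  · refine hO.exists_centreMap_deleteEdgeSet htri hE hz (fun v hv => by simpa using hF v hv) ?_
    intro p q _ hq he
    exact absurd he (M.notMem_singleton_mate x p q hq)
  · refine absurd ?_ h3
    refine ⟨_, _, hasTwoComponents_of_eq (M.adj_of_mem huT hzu) (M.adj_of_mem hwT hzw) huw
      (M.adj_mate x) ?_ ?_ hE, ⟨M.tri z, M.isTriangle_tri z, ?_⟩, ?_, ?_⟩
    · simpa [htri, not_or] using hx
    · simpa [htri, not_or] using hmx
    · intro e he v hv
      simp only [mem_insert, mem_singleton] at he
      rcases he with rfl | rfl <;> rcases Sym2.mem_iff.1 hv with rfl | rfl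
      exacts [M.mem_tri _, huT, M.mem_tri _, hwT]
    · rintro ⟨D, hD, hin⟩
      have h1 := hin _ (mem_singleton_self _) x (by simp)
      have h4 := hin _ (mem_singleton_self _) (M.mate x) (by simp)
      rw [M.eq_tri hD h1] at h4
      exact M.mate_notMem x h4
    · intro hcon
      -- Since `z` keeps only the edge to `mate z`, which is outside `S`, no edge of `G - E` leaves
      -- `S` without `z`.
      obtain ⟨a, ha, b, hb', hadj⟩ := exists_adj_of_preconnected hcon.preconnected
        ((S.erase z : Finset V) : Set V) (x := u) (y := z)
        (by simp [hS z hz u huT, hzu.symm]) (by simp)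
      simp only [coe_erase, Set.mem_sdiff, mem_coe, Set.mem_singleton_iff, not_and, not_not]
        at ha hb'
      have hbz : b ≠ z := by
        rintro rfl
        have := M.eq_mate_of_adj_deleteEdgeSet htri (by simp [hE]) (by simp [hE]) hadj.symm
        exact hmz (this ▸ ha.1)
      have hbS : b ∉ S := fun h => hbz (hb' h)
      rw [deleteEdgeSet_adj] at hadj
      rcases M.adj_iff.1 hadj.1 with h | rfl
      · exact hbS (hS a ha.1 b h.2)
      · rcases hb a ha.1 hbS with h | h
        · exact ha.2 h
        · rw [Set.mem_singleton_iff] at h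
          exact hadj.2 (by simp [hE, h])

theorem exists_centreMap_of_not_conditionE4 (h2 : IsTwoConnected G) (hzu : z ≠ u) (hzw : z ≠ w)
    (huw : u ≠ w) (htri : M.tri z = {z, u, w}) {r p q : V} (hrp : r ≠ p) (hrq : r ≠ q)
    (hpq : p ≠ q) (htri' : M.tri r = {r, p, q}) (hr : r ∉ M.tri z)
    (hE : E = {s(z, u), s(z, w), s(p, q)}) (h4 : ¬ ConditionE4 G E) :
    ∃ c, IsCentreMap (deleteEdgeSet G E) c := by
  have huT : u ∈ M.tri z := by simp [htri]
  have hwT : w ∈ M.tri z := by simp [htri]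
  have hpD : p ∈ M.tri r := by simp [htri']
  have hqD : q ∈ M.tri r := by simp [htri']
  have hDT : ∀ x ∈ M.tri r, x ∉ M.tri z := by
    intro x hx h
    apply hr
    rw [← M.tri_eq h]
    exact M.mem_comm hx
  have hrz : r ≠ z := fun h => hr (h ▸ M.mem_tri z)
  have hadjpq : G.Adj p q := M.adj_of_mem (by rw [M.tri_eq hpD]; exact hqD) hpq
  -- Direction matters: entering the triangle at `r` is harmless, while leaving it at `r` after
  -- entering at `p` or `q` would require the edge `pq`.
  suffices ∃ O, M.IsOutSet O ∧ z ∈ O ∧ r ∉ O by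
    obtain ⟨O, hO, hzO, hrO⟩ := this
    refine hO.exists_centreMap_deleteEdgeSet htri hE hzO ?_ ?_
    · intro v hv h
      rcases Sym2.eq_iff.1 h with ⟨rfl, h'⟩ | ⟨rfl, h'⟩
      · exact M.mate_notMem v (by rw [h', M.tri_eq hpD]; exact hqD)
      · exact M.mate_notMem v (by rw [h', M.tri_eq hqD]; exact hpD)
    · have key : ∀ x, x ∈ M.tri r → x ≠ p → x ≠ q → x ∉ O := by
        intro x hx hxp hxq
        rw [htri'] at hx
        simp only [mem_insert, mem_singleton] at hx
        rcases hx with rfl | rfl | rfl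
        exacts [hrO, absurd rfl hxp, absurd rfl hxq]
      intro a b _ _ he
      rcases Sym2.eq_iff.1 he with ⟨rfl, rfl⟩ | ⟨rfl, rfl⟩
      · exact ⟨hDT _ hpD, fun x hx h1 h3 => key x (M.tri_eq hpD ▸ hx) h1 h3⟩
      · exact ⟨hDT _ hqD, fun x hx h1 h3 => key x (M.tri_eq hqD ▸ hx) h3 h1⟩
  obtain ⟨O, hO, hzO⟩ := M.exists_outSet h2 z
  by_cases hmr : M.mate r = z
  · exact ⟨O, hO, hzO, fun h => hO.mate_notMem r h (hmr ▸ hzO)⟩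
  have hzF : s(z, M.mate z) ∉ ({s(r, M.mate r)} : Set (Sym2 V)) := by
    rw [Set.mem_singleton_iff, Sym2.eq_iff, not_or]
    exact ⟨fun h => hrz h.1.symm, fun h => hmr h.1.symm⟩
  rcases M.exists_outSet_or_separation (M.notMem_singleton_mate r) hzF with
    ⟨O', hO', hz', hF⟩ | ⟨S, hS, hz, hmz, hb⟩
  · exact ⟨O', hO', hz', fun h => hF r h rfl⟩
  by_cases hrS : r ∈ S
  -- With `r` and `z` on the same side, a family leaving at both could not re-enter `S`: the only
  -- crossing edges would both be directed outwards or unused.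
  · refine ⟨O, hO, hzO, fun hrO => ?_⟩
    have h1 := hO.balanced S hS
    have h3 : ({v ∈ O | M.mate v ∈ S} : Finset V) ⊂ {v ∈ O | v ∈ S} := by
      rw [ssubset_iff_of_subset]
      · exact ⟨z, by simp [hzO, hz], by simp [hmz]⟩
      · intro v hv
        rw [mem_filter] at hv ⊢
        refine ⟨hv.1, ?_⟩
        by_contra hvS
        rcases hb _ hv.2 (by rwa [M.mate_mate]) with h | h
        · exact hO.mate_notMem v hv.1 (h ▸ hzO)
        · rw [Set.mem_singleton_iff, Sym2.eq_iff, M.mate_mate] at h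
          rcases h with h | h
          · exact hO.mate_notMem v hv.1 (h.1 ▸ hrO)
          · exact hvS (h.2 ▸ hrS)
    have := card_lt_card h3
    omega
  -- With `r` beyond the cut, `S` witnesses the separation required by (e4).
  · refine absurd ?_ h4
    have hcl : ∀ {a b}, (G.deleteEdges {s(r, M.mate r), s(z, M.mate z)}).Reachable a b →
        a ∈ S → b ∈ S := by
      rintro a b ⟨p⟩ ha
      by_contra hbS
      obtain ⟨d, -, h1, h3⟩ := p.exists_boundary_dart (S : Set V) ha hbS
      have hadj := d.adj
      rw [SimpleGraph.deleteEdges_adj] at hadj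
      rcases M.adj_iff.1 hadj.1 with h | h
      · exact h3 (hS _ h1 _ h.2)
      · rw [h] at hadj h3
        rcases hb _ h1 h3 with h' | h'
        · exact hadj.2 (by simp [h'])
        · rw [Set.mem_singleton_iff] at h'
          exact hadj.2 (by rw [h']; exact Set.mem_insert _ _)
    have hdel : ∀ {a b}, b ∈ M.tri a →
        (G.deleteEdges {s(r, M.mate r), s(z, M.mate z)}).Reachable b a := by
      intro a b hb
      by_cases hab : b = a
      · rw [hab]
      · refine (M.adj_deleteEdges_of_mem ?_ (M.mem_comm hb) hab).reachable
        intro a b hb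
        rw [Set.mem_insert_iff, not_or]
        exact ⟨M.notMem_singleton_mate r a b hb, M.notMem_singleton_mate z a b hb⟩
    refine ⟨_, _, hasTwoComponents_of_eq (M.adj_of_mem huT hzu) (M.adj_of_mem hwT hzw) huw
      hadjpq ?_ ?_ hE, M.tri z, M.tri r, M.isTriangle_tri z, ?_, M.isTriangle_tri r, ?_,
      r, M.mem_tri r, ?_, s(r, M.mate r), M.adj_mate r, by simp, ?_, z, M.mem_tri z, ?_,
      s(z, M.mate z), ?_, by simp, SimpleGraph.connectedComponentMk _ r,
      SimpleGraph.connectedComponentMk _ z, ?_, ?_, ?_⟩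
    · simpa [htri, not_or] using hDT p hpD
    · simpa [htri, not_or] using hDT q hqD
    · intro e he v hv
      simp only [mem_insert, mem_singleton] at he
      rcases he with rfl | rfl <;> rcases Sym2.mem_iff.1 hv with rfl | rfl
      exacts [M.mem_tri _, huT, M.mem_tri _, hwT]
    · intro e he v hv
      rw [mem_singleton] at he
      subst he
      rcases Sym2.mem_iff.1 hv with rfl | rfl
      exacts [hpD, hqD]
    · rw [mem_verts_edgeSpan_singleton hadjpq]
      tauto
    · exact fun h => M.mate_notMem r (h _ (by simp))
    · intro x hx hxz
      rw [htri] at hx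
      simp only [mem_insert, mem_singleton] at hx
      rw [hE]
      rcases hx with rfl | rfl | rfl
      · exact absurd rfl hxz
      · simp
      · simp
    · rw [SimpleGraph.mem_edgeSet, deleteEdgeSet_adj]
      refine ⟨M.adj_mate z, ?_⟩
      rw [hE]
      simp only [mem_insert, mem_singleton, Sym2.eq_iff, not_or, not_and]
      refine ⟨⟨fun _ => M.mate_ne_of_mem huT, fun h => absurd h hzu⟩,
        ⟨fun _ => M.mate_ne_of_mem hwT, fun h => absurd h hzw⟩, ?_, ?_⟩
      · rintro rfl
        exact absurd (M.mem_tri _) (hDT _ hpD)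
      · rintro rfl
        exact absurd (M.mem_tri _) (hDT _ hqD)
    · intro h
      exact hrS (hcl (SimpleGraph.ConnectedComponent.eq.1 h).symm hz)
    · intro v hv
      rw [mem_verts_edgeSpan_singleton hadjpq] at hv
      rw [SimpleGraph.ConnectedComponent.mem_supp_iff, SimpleGraph.ConnectedComponent.eq]
      rcases hv with rfl | rfl
      exacts [hdel hpD, hdel hqD]
    · intro v hv
      rw [mem_verts_edgeSpan_pair (M.adj_of_mem huT hzu) (M.adj_of_mem hwT hzw)] at hv
      rw [SimpleGraph.ConnectedComponent.mem_supp_iff, SimpleGraph.ConnectedComponent.eq]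
      rcases hv with rfl | rfl | rfl
      exacts [SimpleGraph.Reachable.refl _, hdel huT, hdel hwT]

-- If each triangle keeps a path of its own, no cycles are needed. Otherwise each vertex of some
-- triangle loses an edge inside it, so two edges there are deleted, and the position of the third
-- edge decides the case.
include M in
theorem exists_centreMap_of_not_exceptional (h2 : IsTwoConnected G)
    (hEG : (E : Set (Sym2 V)) ⊆ G.edgeSet) (hcard : #E = 3) (h1 : ¬ SpansClaw G E)
    (ht : ¬ SpansTriangle G E) (h3 : ¬ ConditionE3 G E) (h4 : ¬ ConditionE4 G E) :
    ∃ c, IsCentreMap (deleteEdgeSet G E) c := by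
  by_cases hgood : ∀ x, ∃ y ∈ M.tri x, ∀ y' ∈ M.tri x, y' ≠ y → (deleteEdgeSet G E).Adj y y'
  · exact IsOutSet.exists_centreMap (M := M) (O := ∅) ⟨by simp, by simp⟩ (by simp)
      (fun x _ => hgood x) (by simp)
  push Not at hgood
  obtain ⟨x, hx⟩ := hgood
  have hbad : ∀ y ∈ M.tri x, ∃ y' ∈ M.tri x, y' ≠ y ∧ s(y, y') ∈ E := by
    intro y hy
    obtain ⟨y', hy', hne, hadj⟩ := hx y hy
    refine ⟨y', hy', hne, ?_⟩
    by_contra h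
    exact hadj (deleteEdgeSet_adj.2 ⟨M.adj_of_mem (by rwa [M.tri_eq hy]) hne.symm, h⟩)
  obtain ⟨z, hzx, u, hux, w, hwx, hzu, hzw, huw, huE, hwE⟩ : ∃ z ∈ M.tri x, ∃ u ∈ M.tri x,
      ∃ w ∈ M.tri x, z ≠ u ∧ z ≠ w ∧ u ≠ w ∧ s(z, u) ∈ E ∧ s(z, w) ∈ E := by
    obtain ⟨u, hu, hux, huE⟩ := hbad x (M.mem_tri x)
    have hpos : 0 < #(((M.tri x).erase x).erase u) := by
      rw [card_erase_of_mem (mem_erase.2 ⟨hux, hu⟩), card_erase_of_mem (M.mem_tri x), M.card_tri]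
      simp
    obtain ⟨w, hw⟩ := card_pos.1 hpos
    simp only [mem_erase] at hw
    have htri := M.tri_eq_of_mem hu hw.2.2 hux.symm hw.2.1.symm hw.1.symm
    obtain ⟨y, hy, hyw, hyE⟩ := hbad w hw.2.2
    rw [htri] at hy
    simp only [mem_insert, mem_singleton] at hy
    rcases hy with rfl | rfl | rfl
    · exact ⟨y, M.mem_tri y, u, hu, w, hw.2.2, hux.symm, hw.2.1.symm, hw.1.symm, huE,
        by rwa [Sym2.eq_swap]⟩
    · exact ⟨y, hu, x, M.mem_tri x, w, hw.2.2, hux, hyw, hw.2.1.symm, by rwa [Sym2.eq_swap],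
        by rwa [Sym2.eq_swap]⟩
    · exact absurd rfl hyw
  have hT : M.tri x = M.tri z := (M.tri_eq hzx).symm
  rw [hT] at hux hwx
  have htri := M.tri_eq_of_mem hux hwx hzu hzw huw
  have hne : s(z, w) ≠ s(z, u) := by
    intro h
    rcases Sym2.eq_iff.1 h with h | h
    exacts [huw h.2.symm, hzu h.1]
  have hcard1 : #((E.erase s(z, u)).erase s(z, w)) = 1 := by
    rw [card_erase_of_mem (mem_erase.2 ⟨hne, hwE⟩), card_erase_of_mem huE, hcard]
  obtain ⟨e, he⟩ := card_eq_one.1 hcard1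
  have hE : E = {s(z, u), s(z, w), e} := by
    rw [← insert_erase huE, ← insert_erase (mem_erase.2 ⟨hne, hwE⟩), he]
  have heE : e ∈ (E.erase s(z, u)).erase s(z, w) := by rw [he]; simp
  simp only [mem_erase] at heE
  have hadj := hEG heE.2.2
  have hzuA := M.adj_of_mem hux hzu
  have hzwA := M.adj_of_mem hwx hzw
  have huwA := M.adj_of_mem (v := u) (w := w) (by rwa [M.tri_eq hux]) huw
  induction e with | _ p q
  rw [SimpleGraph.mem_edgeSet] at hadj
  rcases M.adj_iff.1 hadj with ⟨hpq, hq⟩ | rfl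
  · by_cases hp : p ∈ M.tri z
    · have hq' : q ∈ M.tri z := by rwa [M.tri_eq hp] at hq
      have : s(p, q) = s(u, w) := by
        rw [htri] at hp hq'
        simp only [mem_insert, mem_singleton] at hp hq'
        rcases hp with rfl | rfl | rfl <;> rcases hq' with rfl | rfl | rfl <;>
          simp_all [Sym2.eq_swap]
      rw [this] at hE
      exact absurd (spansTriangle_of_eq hzuA hzwA huwA hE) ht
    · have hpos : 0 < #(((M.tri p).erase p).erase q) := by
        rw [card_erase_of_mem (mem_erase.2 ⟨hpq.symm, hq⟩), card_erase_of_mem (M.mem_tri p),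
          M.card_tri]
        simp
      obtain ⟨r, hr⟩ := card_pos.1 hpos
      simp only [mem_erase] at hr
      have htr := M.tri_eq hr.2.2
      refine M.exists_centreMap_of_not_conditionE4 h2 hzu hzw huw htri hr.2.1 hr.1 hpq
        (M.tri_eq_of_mem (by rw [htr]; exact M.mem_tri p) (by rwa [htr]) hr.2.1 hr.1 hpq) ?_ hE h4
      intro h
      apply hp
      rw [← M.tri_eq h, htr]
      exact M.mem_tri p
  · have key : ∀ y, E = {s(z, u), s(z, w), s(y, M.mate y)} → y ∈ M.tri z →
        ∃ c, IsCentreMap (deleteEdgeSet G E) c := by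
      intro y hEy hy
      rw [htri] at hy
      simp only [mem_insert, mem_singleton] at hy
      rcases hy with rfl | rfl | rfl
      · exact absurd (spansClaw_of_eq hzuA hzwA (M.adj_mate y) huw (M.mate_ne_of_mem hux).symm
          (M.mate_ne_of_mem hwx).symm hEy) h1
      · exact M.exists_centreMap_of_adjacent h2 hzu hzw huw htri hEy
      · refine M.exists_centreMap_of_adjacent h2 hzw hzu huw.symm (by rw [htri, pair_comm]) ?_
        rw [hEy, insert_comm]
    by_cases hp : p ∈ M.tri z
    · exact key p hE hp
    · by_cases hmp : M.mate p ∈ M.tri z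
      · refine key (M.mate p) ?_ hmp
        rw [M.mate_mate, hE, Sym2.eq_swap (a := p)]
      · exact M.exists_centreMap_of_not_conditionE3 hzu hzw huw htri hp hmp hE h3

end Existence

end TriangleMatching

/-! ### Replacing vertices by triangles -/

section TriangleReplacement

variable {F : SimpleGraph V}

/-- The vertices of `F^Δ` replacing `x`. -/
def dartsFrom (F : SimpleGraph V) (x : V) : Set F.Dart := {a | a.fst = x}

theorem ncard_dartsFrom (hF : IsCubic F) (x : V) : (dartsFrom F x).ncard = 3 := by
  rw [← hF x]
  refine Set.ncard_congr (fun a _ => a.snd) ?_ ?_ ?_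
  · rintro a rfl
    exact a.adj
  · rintro a b ha hb hab
    exact SimpleGraph.Dart.ext _ _ (Prod.ext (Eq.trans ha (Eq.symm hb)) hab)
  · intro y hy
    exact ⟨⟨(x, y), hy⟩, rfl, rfl⟩

theorem isCubic_triangleReplacement [Finite V] (hF : IsCubic F) :
    IsCubic (triangleReplacement F) := by
  classical
  have := Fintype.ofFinite V
  intro a
  have h1 : (triangleReplacement F).neighborSet a =
      insert a.symm (dartsFrom F a.fst \ {a}) := by
    ext b
    simp only [SimpleGraph.mem_neighborSet, triangleReplacement, Set.mem_insert_iff, dartsFrom,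
      Set.mem_sdiff, Set.mem_ofPred_eq, Set.mem_singleton_iff]
    constructor
    · rintro (h | h)
      · exact Or.inr ⟨h.2.symm, h.1.symm⟩
      · exact Or.inl h
    · rintro (h | h)
      · exact Or.inr h
      · exact Or.inl ⟨Ne.symm h.2, h.1.symm⟩
  rw [h1, Set.ncard_insert_of_notMem, Set.ncard_sdiff_singleton_of_mem, ncard_dartsFrom hF]
  · rfl
  · intro h
    exact a.adj.ne (Eq.symm h.1)

/-- A third vertex adjacent to both a dart and its reverse would have to share its origin with each.
-/
theorem fst_eq_of_triangle {T : Finset F.Dart} (hT : IsTriangle (triangleReplacement F) T)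
    {a b : F.Dart} (ha : a ∈ T) (hb : b ∈ T) : b.fst = a.fst := by
  classical
  by_cases hab : a = b
  · rw [hab]
  rcases hT.1 ha hb hab with h | rfl
  · exact h.2.symm
  have hpos : 0 < #((T.erase a).erase a.symm) := by
    rw [card_erase_of_mem (mem_erase.2 ⟨Ne.symm hab, hb⟩), card_erase_of_mem ha, hT.2]
    simp
  obtain ⟨d, hd⟩ := card_pos.1 hpos
  simp only [mem_erase] at hd
  rcases hT.1 ha hd.2.2 hd.2.1.symm with h | h
  · rcases hT.1 hb hd.2.2 hd.1.symm with h' | h'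
    · exact h'.2.trans h.2.symm
    · rw [SimpleGraph.Dart.symm_symm] at h'
      exact absurd h' hd.2.1
  · exact absurd h hd.1

theorem uniqueTriangles_triangleReplacement [Finite V] (hF : IsCubic F) :
    UniqueTriangles (triangleReplacement F) := by
  classical
  have := Fintype.ofFinite V
  intro a
  have hcard : #(dartsFrom F a.fst).toFinset = 3 := by
    rw [← ncard_dartsFrom hF a.fst, Set.ncard_eq_toFinset_card']
  refine ⟨(dartsFrom F a.fst).toFinset, ⟨⟨?_, hcard⟩, ?_⟩, ?_⟩
  · intro b hb d hd hbd
    rw [mem_coe, Set.mem_toFinset] at hb hd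
    exact Or.inl ⟨hbd, Eq.trans hb (Eq.symm hd)⟩
  · rw [Set.mem_toFinset]
    rfl
  · rintro T ⟨hT, ha⟩
    apply eq_of_subset_of_card_le
    · intro b hb
      rw [Set.mem_toFinset]
      exact fst_eq_of_triangle hT ha hb
    · rw [hcard, hT.2]

/-- A set of darts, other than `a`, that is closed under adjacency avoiding `a` contains all darts
but `a`. -/
theorem mem_of_closed_triangleReplacement [Finite V] (hF : IsTwoConnected F) (a : F.Dart)
    {S : Set F.Dart} (hS : ∀ b ∈ S, ∀ d, d ≠ a → (triangleReplacement F).Adj b d → d ∈ S)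
    {b d : F.Dart} (hb : b ∈ S) (hba : b ≠ a) (hda : d ≠ a) : d ∈ S := by
  have hsymm : ∀ {b : F.Dart}, b.fst = a.fst → b.symm ≠ a := by
    rintro b hb rfl
    exact b.adj.ne hb
  have hne : ∀ {b : F.Dart}, b.fst ≠ a.fst → b ≠ a := by
    rintro b hb rfl
    exact hb rfl
  have hsame : ∀ {b d : F.Dart}, b ∈ S → d ≠ a → b.fst = d.fst → d ∈ S := by
    intro b d hb hd h
    by_cases hbd : b = d
    · exact hbd ▸ hb
    · exact hS b hb d hd (Or.inl ⟨hbd, h⟩)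
  -- The argument steps out of the triangle of `a`, spreads through `F` minus `a.fst`, and returns
  -- to the remaining darts at `a.fst` through their reverses.
  obtain ⟨b', hb', hba'⟩ : ∃ b' ∈ S, b'.fst ≠ a.fst := by
    by_cases h : b.fst = a.fst
    · refine ⟨b.symm, hS b hb _ (hsymm h) (Or.inr rfl), ?_⟩
      rw [← h]
      exact b.adj.ne'
    · exact ⟨b, hb, h⟩
  have hfar : ∀ d : F.Dart, d.fst ≠ a.fst → d ∈ S := by
    intro d hd
    by_contra hdS
    obtain ⟨⟨u, hu⟩, ⟨d₁, hd₁, h1⟩, ⟨v, hv⟩, hvS, hadj⟩ := exists_adj_of_preconnected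
      (hF.2.2 a.fst).preconnected {x | ∃ d ∈ S, d.fst = x.1} (x := ⟨b'.fst, hba'⟩)
      (y := ⟨d.fst, hd⟩) ⟨b', hb', rfl⟩
      (fun ⟨d', hd', h⟩ => hdS (hsame hd' (hne hd) h))
    have huv : F.Adj u v := hadj
    let e : F.Dart := ⟨(u, v), huv⟩
    have he : e ∈ S := hsame hd₁ (hne hu) h1
    exact hvS ⟨e.symm, hS e he _ (hne hv) (Or.inr rfl), rfl⟩
  by_cases h : d.fst = a.fst
  · have h1 : d.symm ∈ S := hfar _ (by rw [← h]; exact d.adj.ne')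
    exact hS _ h1 _ hda (Or.inr (SimpleGraph.Dart.symm_symm d).symm)
  · exact hfar d h

/-- One closure lemma serves both the graph minus `a` and the whole graph, where `a` itself is
reached from `a.symm`. -/
theorem isTwoConnected_triangleReplacement [Finite V] (hc : IsCubic F) (hF : IsTwoConnected F) :
    IsTwoConnected (triangleReplacement F) := by
  classical
  have := Fintype.ofFinite V
  have hdel : ∀ a : F.Dart, ((triangleReplacement F).induce {a}ᶜ).Connected := by
    intro a
    refine connected_of_forall_closed ⟨a.symm, a.symm_ne⟩ ?_
    rintro S hS ha ⟨d, hd⟩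
    have := mem_of_closed_triangleReplacement hF a (S := Subtype.val '' S) ?_
      (b := a.symm) ⟨_, ha, rfl⟩ a.symm_ne hd
    · obtain ⟨d', hd', h⟩ := this
      rwa [show d' = ⟨d, hd⟩ from Subtype.ext h] at hd'
    · rintro _ ⟨b, hb, rfl⟩ d hda hadj
      exact ⟨⟨d, hda⟩, hS b hb ⟨d, hda⟩ hadj, rfl⟩
  obtain ⟨x⟩ := hF.2.1.nonempty
  have hcard := ncard_dartsFrom hc x
  obtain ⟨a, ha⟩ := Set.nonempty_of_ncard_ne_zero (by omega : (dartsFrom F x).ncard ≠ 0)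
  refine ⟨?_, ?_, hdel⟩
  · rw [← hcard, ← Set.ncard_univ]
    exact Set.ncard_le_ncard (Set.subset_univ _) (Set.toFinite _)
  · refine connected_of_forall_closed a.symm ?_
    intro S hS hSa d
    by_cases hda : d = a
    · subst hda
      exact hS _ hSa _ (Or.inr (SimpleGraph.Dart.symm_symm d).symm)
    · exact mem_of_closed_triangleReplacement hF a (fun b hb d _ h => hS b hb d h) hSa
        a.symm_ne hda

end TriangleReplacement

end LambdaFactor

theorem mainTheorem6 {V W : Type*} [Finite V] [Finite W] :
    (∀ G : SimpleGraph V, LambdaFactor.IsCubic G → LambdaFactor.IsTwoConnected G →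
      LambdaFactor.UniqueTriangles G →
      ∀ E : Finset (Sym2 V), (E : Set (Sym2 V)) ⊆ G.edgeSet → E.card = 3 →
        (¬ LambdaFactor.HasLambdaFactor (LambdaFactor.deleteEdgeSet G E) ↔
          (LambdaFactor.SpansClaw G E ∨ LambdaFactor.SpansTriangle G E ∨
            LambdaFactor.ConditionE3 G E ∨ LambdaFactor.ConditionE4 G E))) ∧
    (∀ F : SimpleGraph W, LambdaFactor.IsCubic F → LambdaFactor.IsTwoConnected F →
      LambdaFactor.IsCubic (LambdaFactor.triangleReplacement F) ∧
      LambdaFactor.IsTwoConnected (LambdaFactor.triangleReplacement F) ∧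
      LambdaFactor.UniqueTriangles (LambdaFactor.triangleReplacement F)) := by
  classical
  have := Fintype.ofFinite V
  refine ⟨fun G hc h2 hu E hEG hcard => ?_, fun F hc h2 =>
    ⟨LambdaFactor.isCubic_triangleReplacement hc,
      LambdaFactor.isTwoConnected_triangleReplacement hc h2,
      LambdaFactor.uniqueTriangles_triangleReplacement hc⟩⟩
  obtain ⟨M⟩ := LambdaFactor.exists_triangleMatching hc hu
  constructor
  · intro h
    by_contra! hno
    obtain ⟨c, hcm⟩ := M.exists_centreMap_of_not_exceptional h2 hEG hcard hno.1 hno.2.1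
      hno.2.2.1 hno.2.2.2
    exact h hcm.hasLambdaFactor
  · intro h hfac
    obtain ⟨c, hcm⟩ := hfac.exists_centreMap
    rcases h with h | h | h | h
    · exact LambdaFactor.TriangleMatching.not_spansClaw hc hcm h
    · exact M.not_spansTriangle hcm h
    · exact M.not_conditionE3 h2 hEG hcm h
    · exact M.not_conditionE4 h2 hEG hcm h
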